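/- Let $G\colon\mathbb R^n\to[0,\infty)$ be convex and even with $G(0)=0$, supercoercive ($\lim_{|x|\to\infty}G(x)/|x|=\infty$), and satisfy - ($\Delta_2$) there are $K_1\ge 2$ and $M_1>0$ with $G(2x)\le K_1G(x)$ whenever $|x|\ge M_1$; - ($\nabla_2$) there are $K_2\ge 1$ and $M_2>0$ with $G(x)\le \frac1{2K_2}G(K_2x)$ whenever $|x|\ge M_2$. Let $I\subset\mathbb R$ be a bounded interval. Let $L^G(I,\mathbb R^n)$ be the space of (classes modulo equality a.e. of) measurable functions $u\colon I\to\mathbb R^n$ with $\int_I G(u)\,dt<\infty$, equipped with the Luxemburg norm $$\|u\|_G=\inf\Big\{\alpha>0:\ \int_I G\big(\tfrac{u}{\alpha}\big)\,dt\le 1\Big\},$$ and let $$W^1L^G(I,\mathbb R^n)=\{u\in L^G(I,\mathbb R^n):\ \dot u\in L^G(I,\mathbb R^n)\},\qquad \|u\|_{W^1L^G}=\|u\|_G+\|\dot u\|_G,$$ where $\dot u$ is the weak derivative of $u$ on $I$. Then $(W^1L^G(I,\mathbb R^n),\|\cdot\|_{W^1L^G})$ is a separable reflexive Banach space. -/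

import Mathlib

open MeasureTheory Set Filter
open scoped ENNReal

noncomputable section

/-- Finite-valued convex even `G : ℝⁿ → [0,∞)`, `G 0 = 0`, supercoercive, satisfying the
`Δ₂` and `∇₂` conditions (at infinity). -/
structure GFunction (n : ℕ) where
  toFun : EuclideanSpace ℝ (Fin n) → ℝ
  nonneg : ∀ x, 0 ≤ toFun x
  map_zero : toFun 0 = 0
  convex : ConvexOn ℝ univ toFun
  even : ∀ x, toFun (-x) = toFun x
  supercoercive : Tendsto (fun x => toFun x / ‖x‖)
    (Bornology.cobounded (EuclideanSpace ℝ (Fin n))) atTop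
  delta2 : ∃ K₁ : ℝ, 2 ≤ K₁ ∧ ∃ M₁ : ℝ, 0 < M₁ ∧ ∀ x, M₁ ≤ ‖x‖ →
    toFun ((2 : ℝ) • x) ≤ K₁ * toFun x
  nabla2 : ∃ K₂ : ℝ, 1 ≤ K₂ ∧ ∃ M₂ : ℝ, 0 < M₂ ∧ ∀ x, M₂ ≤ ‖x‖ →
    toFun x ≤ 1 / (2 * K₂) * toFun (K₂ • x)

instance (n : ℕ) : CoeFun (GFunction n) (fun _ => EuclideanSpace ℝ (Fin n) → ℝ) :=
  ⟨GFunction.toFun⟩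

/-- A finite (i.e. bounded) interval of the real line, open, closed or half-open. -/
structure FiniteInterval where
  carrier : Set ℝ
  ordConnected : carrier.OrdConnected
  isBounded : Bornology.IsBounded carrier

/-- Lebesgue measure on the interval. -/
abbrev FiniteInterval.measure (I : FiniteInterval) : Measure ℝ := volume.restrict I.carrier

/-- Classes of measurable functions `I → ℝⁿ` modulo equality almost everywhere on `I`. -/
abbrev MeasurableClass (n : ℕ) (I : FiniteInterval) : Type :=
  ℝ →ₘ[I.measure] EuclideanSpace ℝ (Fin n)

/-- `∫_I G(u) dt ∈ [0,∞]`. -/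
def modular {n : ℕ} (G : GFunction n) (I : FiniteInterval) (u : MeasurableClass n I) : ℝ≥0∞ :=
  ∫⁻ t in I.carrier, ENNReal.ofReal (G (u t))

/-- The Luxemburg norm `inf {α > 0 : ∫_I G(u/α) dt ≤ 1}`. -/
def luxemburgNorm {n : ℕ} (G : GFunction n) (I : FiniteInterval) (u : MeasurableClass n I) : ℝ :=
  sInf {α : ℝ | 0 < α ∧ modular G I (α⁻¹ • u) ≤ 1}

/-- `g` is the weak derivative of `f` in the interior of `J ⊆ ℝ`. -/
def HasWeakDerivOn {n : ℕ} (f g : ℝ → EuclideanSpace ℝ (Fin n)) (J : Set ℝ) : Prop :=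
  LocallyIntegrableOn f (interior J) ∧ LocallyIntegrableOn g (interior J) ∧
    ∀ φ : ℝ → ℝ, ContDiff ℝ (⊤ : ℕ∞) φ → HasCompactSupport φ → tsupport φ ⊆ interior J →
      ∫ t in J, deriv φ t • f t = - ∫ t in J, φ t • g t

namespace GFunction

variable {n : ℕ} (G : GFunction n)

theorem continuous : Continuous G :=
  G.convex.locallyLipschitz.continuous

theorem smul_le {t : ℝ} (h0 : 0 ≤ t) (h1 : t ≤ 1) (x : EuclideanSpace ℝ (Fin n)) :
    G (t • x) ≤ t * G x := by
  have := G.convex.2 (mem_univ x) (mem_univ 0) h0 (sub_nonneg.2 h1) (by ring)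
  simpa [G.map_zero] using this

theorem abs_smul (t : ℝ) (x : EuclideanSpace ℝ (Fin n)) : G (|t| • x) = G (t • x) := by
  rcases abs_choice t with h | h <;> rw [h]
  rw [neg_smul, G.even]

theorem smul_mono {s t : ℝ} (h0 : 0 ≤ s) (h : s ≤ t) (x : EuclideanSpace ℝ (Fin n)) :
    G (s • x) ≤ G (t • x) := by
  rcases h0.eq_or_lt with rfl | hs
  · simpa [G.map_zero] using G.nonneg _
  have ht : 0 < t := hs.trans_le h
  have h1 : s / t ≤ 1 := (div_le_one ht).2 h
  have := G.smul_le (t := s / t) (by positivity) h1 (t • x)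
  rw [smul_smul, div_mul_cancel₀ _ ht.ne'] at this
  exact this.trans (mul_le_of_le_one_left (G.nonneg _) h1)

theorem two_smul_le : ∃ C K : ℝ, 0 ≤ C ∧ 0 ≤ K ∧ ∀ x, G ((2 : ℝ) • x) ≤ C + K * G x := by
  obtain ⟨K, hK, M, -, h⟩ := G.delta2
  obtain ⟨C, hC⟩ := (isCompact_closedBall (0 : EuclideanSpace ℝ (Fin n)) M).exists_bound_of_continuousOn
    (f := fun x => G ((2 : ℝ) • x)) (G.continuous.comp (continuous_const_smul _)).continuousOn
  refine ⟨|C|, K, abs_nonneg _, by linarith, fun x => ?_⟩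
  have h3 : 0 ≤ K * G x := mul_nonneg (by linarith) (G.nonneg x)
  rcases le_total ‖x‖ M with hx | hx
  · have h1 := (le_abs_self _).trans (hC x (by simpa using hx))
    linarith [le_abs_self C]
  · linarith [h x hx, abs_nonneg C]

theorem norm_le : ∃ R : ℝ, 0 ≤ R ∧ ∀ x, ‖x‖ ≤ R + G x := by
  have h := G.supercoercive.eventually_ge_atTop 1
  obtain ⟨R, -, hR⟩ := (Metric.hasBasis_cobounded_compl_closedBall
    (0 : EuclideanSpace ℝ (Fin n))).eventually_iff.1 h
  refine ⟨|R|, abs_nonneg _, fun x => ?_⟩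
  rcases le_or_gt ‖x‖ |R| with hx | hx
  · linarith [G.nonneg x]
  · have h1 := hR (x := x) (by simpa using (le_abs_self R).trans_lt hx)
    have hp : 0 < ‖x‖ := (abs_nonneg R).trans_lt hx
    have h2 : 1 ≤ G x / ‖x‖ := h1
    rw [le_div_iff₀ hp] at h2
    linarith [abs_nonneg R]

end GFunction

section Modular

variable {n : ℕ} (G : GFunction n) (I : FiniteInterval)

instance : IsFiniteMeasure I.measure :=
  ⟨by simpa using I.isBounded.measure_lt_top⟩

theorem aemeasurable_comp (u : MeasurableClass n I) :
    AEMeasurable (fun t => ENNReal.ofReal (G (u t))) I.measure :=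
  (G.continuous.measurable.comp_aemeasurable u.aestronglyMeasurable.aemeasurable).ennreal_ofReal

theorem modular_smul_eq (c : ℝ) (u : MeasurableClass n I) :
    modular G I (c • u) = ∫⁻ t in I.carrier, ENNReal.ofReal (G (c • u t)) := by
  refine lintegral_congr_ae ?_
  filter_upwards [AEEqFun.coeFn_smul c u] with t ht
  rw [ht, Pi.smul_apply]

theorem modular_smul_mono {s t : ℝ} (h : |s| ≤ |t|) (u : MeasurableClass n I) :
    modular G I (s • u) ≤ modular G I (t • u) := by
  rw [modular_smul_eq, modular_smul_eq]
  refine lintegral_mono fun x => ENNReal.ofReal_le_ofReal ?_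
  rw [← G.abs_smul s, ← G.abs_smul t]
  exact G.smul_mono (abs_nonneg _) h _

theorem modular_two_smul_lt {u : MeasurableClass n I} (hu : modular G I u < ∞) :
    modular G I ((2 : ℝ) • u) < ∞ := by
  obtain ⟨C, K, hC, hK, h⟩ := G.two_smul_le
  rw [modular_smul_eq]
  calc ∫⁻ t in I.carrier, ENNReal.ofReal (G ((2 : ℝ) • u t))
      ≤ ∫⁻ t in I.carrier, (ENNReal.ofReal C + ENNReal.ofReal K * ENNReal.ofReal (G (u t))) := by
        refine lintegral_mono fun t => ?_
        rw [← ENNReal.ofReal_mul hK, ← ENNReal.ofReal_add hC (mul_nonneg hK (G.nonneg _))]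
        exact ENNReal.ofReal_le_ofReal (h _)
    _ = ENNReal.ofReal C * I.measure univ + ENNReal.ofReal K * modular G I u := by
        rw [lintegral_add_left measurable_const, lintegral_const,
          lintegral_const_mul' _ _ ENNReal.ofReal_ne_top, modular]
    _ < ∞ := ENNReal.add_lt_top.2 ⟨ENNReal.mul_lt_top ENNReal.ofReal_lt_top (measure_lt_top _ _),
        ENNReal.mul_lt_top ENNReal.ofReal_lt_top hu⟩

theorem modular_smul_lt (c : ℝ) {u : MeasurableClass n I} (hu : modular G I u < ∞) :
    modular G I (c • u) < ∞ := by
  have h2 : ∀ k : ℕ, modular G I ((2 : ℝ) ^ k • u) < ∞ := by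
    intro k
    induction k with
    | zero => simpa using hu
    | succ k ih =>
      rw [pow_succ', ← smul_smul]
      exact modular_two_smul_lt G I ih
  obtain ⟨k, hk⟩ := pow_unbounded_of_one_lt |c| (one_lt_two : (1 : ℝ) < 2)
  exact (modular_smul_mono G I (by rw [abs_of_pos (by positivity : (0 : ℝ) < 2 ^ k)]; exact hk.le)
    u).trans_lt (h2 k)

theorem modular_convex {a b : ℝ} (ha : 0 ≤ a) (hb : 0 ≤ b) (hab : a + b = 1)
    (u v : MeasurableClass n I) :
    modular G I (a • u + b • v) ≤
      ENNReal.ofReal a * modular G I u + ENNReal.ofReal b * modular G I v := by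
  calc modular G I (a • u + b • v)
      = ∫⁻ t in I.carrier, ENNReal.ofReal (G (a • u t + b • v t)) := by
        refine lintegral_congr_ae ?_
        filter_upwards [AEEqFun.coeFn_add (a • u) (b • v), AEEqFun.coeFn_smul a u,
          AEEqFun.coeFn_smul b v] with t h1 h2 h3
        rw [h1, Pi.add_apply, h2, h3, Pi.smul_apply, Pi.smul_apply]
    _ ≤ ∫⁻ t in I.carrier, (ENNReal.ofReal a * ENNReal.ofReal (G (u t)) +
          ENNReal.ofReal b * ENNReal.ofReal (G (v t))) := by
        refine lintegral_mono fun t => ?_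
        rw [← ENNReal.ofReal_mul ha, ← ENNReal.ofReal_mul hb,
          ← ENNReal.ofReal_add (mul_nonneg ha (G.nonneg _)) (mul_nonneg hb (G.nonneg _))]
        exact ENNReal.ofReal_le_ofReal (G.convex.2 (mem_univ _) (mem_univ _) ha hb hab)
    _ = _ := by
        rw [lintegral_add_left' ((aemeasurable_comp G I u).const_mul _),
          lintegral_const_mul' _ _ ENNReal.ofReal_ne_top,
          lintegral_const_mul' _ _ ENNReal.ofReal_ne_top, modular, modular]

theorem modular_add_lt {u v : MeasurableClass n I} (hu : modular G I u < ∞)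
    (hv : modular G I v < ∞) : modular G I (u + v) < ∞ := by
  have h := modular_convex G I (a := 1 / 2) (b := 1 / 2) (by norm_num) (by norm_num) (by norm_num)
    ((2 : ℝ) • u) ((2 : ℝ) • v)
  rw [smul_smul, smul_smul] at h
  norm_num at h
  refine h.trans_lt (ENNReal.add_lt_top.2 ⟨?_, ?_⟩)
  · exact ENNReal.mul_lt_top (by simp) (modular_two_smul_lt G I hu)
  · exact ENNReal.mul_lt_top (by simp) (modular_two_smul_lt G I hv)

theorem class_smul_zero (c : ℝ) : c • (0 : MeasurableClass n I) = 0 :=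
  smul_zero (A := MeasurableClass n I) c

theorem class_zero_smul (u : MeasurableClass n I) : (0 : ℝ) • u = 0 :=
  zero_smul ℝ u

theorem modular_zero : modular G I 0 = 0 := by
  have := modular_smul_eq G I 0 0
  rw [class_zero_smul] at this
  simpa [G.map_zero] using this

theorem lintegral_enorm_le {R : ℝ} (hR0 : 0 ≤ R) (hR : ∀ x, ‖x‖ ≤ R + G x)
    (u : MeasurableClass n I) :
    ∫⁻ t in I.carrier, ‖u t‖ₑ ≤ ENNReal.ofReal R * I.measure univ + modular G I u := by
  calc ∫⁻ t in I.carrier, ‖u t‖ₑ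
      ≤ ∫⁻ t in I.carrier, (ENNReal.ofReal R + ENNReal.ofReal (G (u t))) := by
        refine lintegral_mono fun t => ?_
        rw [← ENNReal.ofReal_add hR0 (G.nonneg _), ← ofReal_norm]
        exact ENNReal.ofReal_le_ofReal (hR _)
    _ = _ := by rw [lintegral_add_left measurable_const, lintegral_const, modular]

theorem integrable_of_modular_lt {u : MeasurableClass n I} (hu : modular G I u < ∞) :
    Integrable u I.measure := by
  obtain ⟨R, hR0, hR⟩ := G.norm_le
  refine ⟨u.aestronglyMeasurable, (lintegral_enorm_le G I hR0 hR u).trans_lt ?_⟩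
  exact ENNReal.add_lt_top.2 ⟨ENNReal.mul_lt_top ENNReal.ofReal_lt_top (measure_lt_top _ _), hu⟩

/-- The set of admissible constants in the Luxemburg norm is non-empty. -/
theorem luxemburg_set_nonempty {u : MeasurableClass n I} (hu : modular G I u < ∞) :
    {α : ℝ | 0 < α ∧ modular G I (α⁻¹ • u) ≤ 1}.Nonempty := by
  set m := (modular G I u).toReal with hm
  have hm0 : 0 ≤ m := ENNReal.toReal_nonneg
  have hp : 0 < m + 1 := by linarith
  refine ⟨m + 1, hp, ?_⟩
  have h1 : (m + 1)⁻¹ ≤ 1 := inv_le_one_of_one_le₀ (by linarith)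
  have h := modular_convex G I (a := (m + 1)⁻¹) (b := 1 - (m + 1)⁻¹) (by positivity)
    (by linarith) (by ring) u 0
  rw [class_smul_zero, add_zero, modular_zero, mul_zero, add_zero] at h
  refine h.trans ?_
  rw [← ENNReal.ofReal_toReal hu.ne, ← hm, ← ENNReal.ofReal_mul (by positivity),
    ENNReal.ofReal_le_one, inv_mul_le_iff₀ hp]
  linarith

theorem luxemburg_bddBelow (u : MeasurableClass n I) :
    BddBelow {α : ℝ | 0 < α ∧ modular G I (α⁻¹ • u) ≤ 1} :=
  ⟨0, fun _ h => h.1.le⟩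

theorem luxemburgNorm_nonneg (u : MeasurableClass n I) : 0 ≤ luxemburgNorm G I u :=
  Real.sInf_nonneg fun _ h => h.1.le

theorem luxemburgNorm_zero : luxemburgNorm G I 0 = 0 := by
  refine le_antisymm (le_of_forall_pos_le_add fun ε hε => ?_) (luxemburgNorm_nonneg G I 0)
  rw [zero_add]
  exact csInf_le (luxemburg_bddBelow G I 0) ⟨hε, by simp [class_smul_zero, modular_zero]⟩

theorem luxemburgNorm_smul_le (c : ℝ) (hc : c ≠ 0) {u : MeasurableClass n I}
    (hu : modular G I u < ∞) : luxemburgNorm G I (c • u) ≤ |c| * luxemburgNorm G I u := by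
  have hc' : 0 < |c| := abs_pos.2 hc
  rw [mul_comm, ← div_le_iff₀ hc']
  refine le_csInf (luxemburg_set_nonempty G I hu) fun α hα => ?_
  rw [div_le_iff₀ hc']
  refine csInf_le (luxemburg_bddBelow G I _) ⟨mul_pos hα.1 hc', le_trans ?_ hα.2⟩
  rw [smul_smul]
  refine modular_smul_mono G I (le_of_eq ?_) u
  rw [abs_mul, abs_inv, abs_mul, abs_abs, abs_inv]
  field_simp

theorem luxemburgNorm_smul (c : ℝ) {u : MeasurableClass n I} (hu : modular G I u < ∞) :
    luxemburgNorm G I (c • u) = |c| * luxemburgNorm G I u := by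
  rcases eq_or_ne c 0 with rfl | hc
  · simp [class_zero_smul, luxemburgNorm_zero]
  refine le_antisymm (luxemburgNorm_smul_le G I c hc hu) ?_
  have h := luxemburgNorm_smul_le G I c⁻¹ (inv_ne_zero hc) (modular_smul_lt G I c hu)
  rw [smul_smul, inv_mul_cancel₀ hc, one_smul, abs_inv, inv_mul_eq_div,
    le_div_iff₀ (abs_pos.2 hc)] at h
  linarith

theorem luxemburgNorm_add_le {u v : MeasurableClass n I} (hu : modular G I u < ∞)
    (hv : modular G I v < ∞) :
    luxemburgNorm G I (u + v) ≤ luxemburgNorm G I u + luxemburgNorm G I v := by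
  have key : ∀ α ∈ {α : ℝ | 0 < α ∧ modular G I (α⁻¹ • u) ≤ 1},
      ∀ β ∈ {β : ℝ | 0 < β ∧ modular G I (β⁻¹ • v) ≤ 1},
        luxemburgNorm G I (u + v) ≤ α + β := by
    rintro α ⟨hα, hα1⟩ β ⟨hβ, hβ1⟩
    have hs : 0 < α + β := add_pos hα hβ
    refine csInf_le (luxemburg_bddBelow G I _) ⟨hs, ?_⟩
    have h := modular_convex G I (a := α / (α + β)) (b := β / (α + β)) (by positivity)
      (by positivity) (by field_simp) (α⁻¹ • u) (β⁻¹ • v)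
    have e : (α / (α + β)) • α⁻¹ • u + (β / (α + β)) • β⁻¹ • v = (α + β)⁻¹ • (u + v) := by
      rw [smul_smul, smul_smul, smul_add]
      congr 2 <;> field_simp
    rw [e] at h
    refine h.trans ((add_le_add (mul_le_mul_right hα1 _) (mul_le_mul_right hβ1 _)).trans ?_)
    rw [mul_one, mul_one, ← ENNReal.ofReal_add (by positivity) (by positivity),
      ENNReal.ofReal_le_one]
    exact le_of_eq (by field_simp)
  have h1 : ∀ α ∈ {α : ℝ | 0 < α ∧ modular G I (α⁻¹ • u) ≤ 1},
      luxemburgNorm G I (u + v) - α ≤ luxemburgNorm G I v := fun α hα =>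
    le_csInf (luxemburg_set_nonempty G I hv) fun β hβ => by linarith [key α hα β hβ]
  have h2 : luxemburgNorm G I (u + v) - luxemburgNorm G I v ≤ luxemburgNorm G I u :=
    le_csInf (luxemburg_set_nonempty G I hu) fun α hα => by linarith [h1 α hα]
  linarith

theorem eq_zero_of_luxemburgNorm_eq_zero {u : MeasurableClass n I} (hu : modular G I u < ∞)
    (h : luxemburgNorm G I u = 0) : u = 0 := by
  obtain ⟨R, hR0, hR⟩ := G.norm_le
  set C : ℝ≥0∞ := ENNReal.ofReal R * I.measure univ + 1 with hC
  have hCt : C ≠ ∞ := by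
    rw [hC]
    exact ENNReal.add_ne_top.2 ⟨ENNReal.mul_ne_top ENNReal.ofReal_ne_top (measure_ne_top _ _),
      ENNReal.one_ne_top⟩
  have key : ∀ ε : ℝ, 0 < ε → ∫⁻ t in I.carrier, ‖u t‖ₑ ≤ ENNReal.ofReal ε * C := by
    intro ε hε
    obtain ⟨α, ⟨hα, hα1⟩, hαε⟩ := exists_lt_of_csInf_lt (luxemburg_set_nonempty G I hu)
      (show sInf {α : ℝ | 0 < α ∧ modular G I (α⁻¹ • u) ≤ 1} < ε by
        rw [← luxemburgNorm, h]; exact hε)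
    have h1 := (lintegral_enorm_le G I hR0 hR (α⁻¹ • u)).trans (add_le_add_right hα1 _)
    have h2 : ∫⁻ t in I.carrier, ‖u t‖ₑ
        = ENNReal.ofReal α * ∫⁻ t in I.carrier, ‖(α⁻¹ • u) t‖ₑ := by
      rw [← lintegral_const_mul' _ _ ENNReal.ofReal_ne_top]
      refine lintegral_congr_ae ?_
      filter_upwards [AEEqFun.coeFn_smul α⁻¹ u] with t ht
      rw [ht, Pi.smul_apply, ← ofReal_norm, ← ofReal_norm,
        ← ENNReal.ofReal_mul hα.le, norm_smul, norm_inv, Real.norm_of_nonneg hα.le,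
        mul_inv_cancel_left₀ hα.ne']
    rw [h2]
    exact mul_le_mul' (ENNReal.ofReal_le_ofReal hαε.le) h1
  have h0 : ∫⁻ t in I.carrier, ‖u t‖ₑ = 0 := by
    have hlim : Tendsto (fun ε : ℝ => ENNReal.ofReal ε * C) (nhdsWithin 0 (Ioi 0)) (nhds 0) := by
      have := ENNReal.Tendsto.mul_const (b := C)
        (ENNReal.tendsto_ofReal (tendsto_id (α := ℝ) (x := nhds 0))) (Or.inr hCt)
      simp only [ENNReal.ofReal_zero, zero_mul, id] at this
      exact this.mono_left nhdsWithin_le_nhds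
    exact le_antisymm (ge_of_tendsto hlim (eventually_nhdsWithin_of_forall fun ε hε => key ε hε))
      bot_le
  rw [lintegral_eq_zero_iff' u.aestronglyMeasurable.enorm] at h0
  refine AEEqFun.ext ?_
  filter_upwards [h0, AEEqFun.coeFn_zero (α := ℝ) (μ := I.measure)
    (β := EuclideanSpace ℝ (Fin n))] with t h1 h2
  rw [h2]
  simpa using h1

end Modular

/-- `L^G(I, ℝⁿ)` as a linear subspace of the classes of measurable functions. -/
def orliczSubmodule {n : ℕ} (G : GFunction n) (I : FiniteInterval) :
    Submodule ℝ (MeasurableClass n I) where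
  carrier := {u | modular G I u < ∞}
  add_mem' := modular_add_lt G I
  zero_mem' := by simp [modular_zero]
  smul_mem' c _ := modular_smul_lt G I c

/-- The Orlicz space `L^G(I, ℝⁿ)`. -/
def OrliczSpace {n : ℕ} (G : GFunction n) (I : FiniteInterval) : Type :=
  ↥(orliczSubmodule G I)

namespace OrliczSpace

variable {n : ℕ} {G : GFunction n} {I : FiniteInterval}

instance : AddCommGroup (OrliczSpace G I) := inferInstanceAs (AddCommGroup (orliczSubmodule G I))

instance : Module ℝ (OrliczSpace G I) := inferInstanceAs (Module ℝ (orliczSubmodule G I))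

/-- The underlying class of measurable functions. -/
def toClass : OrliczSpace G I →ₗ[ℝ] MeasurableClass n I := (orliczSubmodule G I).subtype

theorem modular_lt (u : OrliczSpace G I) : modular G I u.toClass < ∞ := u.2

theorem toClass_injective : Function.Injective (toClass : OrliczSpace G I → MeasurableClass n I) :=
  Subtype.val_injective

/-- `L^G(I, ℝⁿ)` carries the Luxemburg norm. -/
instance : Norm (OrliczSpace G I) := ⟨fun u => luxemburgNorm G I u.toClass⟩

theorem norm_def (u : OrliczSpace G I) : ‖u‖ = luxemburgNorm G I u.toClass := rfl

theorem core : NormedSpace.Core ℝ (OrliczSpace G I) where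
  norm_nonneg u := luxemburgNorm_nonneg G I _
  norm_smul c u := by
    rw [norm_def, norm_def, map_smul, luxemburgNorm_smul G I c u.modular_lt, Real.norm_eq_abs]
  norm_triangle u v := by
    rw [norm_def, norm_def, norm_def, map_add]
    exact luxemburgNorm_add_le G I u.modular_lt v.modular_lt
  norm_eq_zero_iff u := by
    refine ⟨fun h => toClass_injective ?_, fun h => ?_⟩
    · rw [map_zero]
      exact eq_zero_of_luxemburgNorm_eq_zero G I u.modular_lt h
    · rw [h, norm_def, map_zero, luxemburgNorm_zero]

instance : NormedAddCommGroup (OrliczSpace G I) := NormedAddCommGroup.ofCore core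

instance : NormedSpace ℝ (OrliczSpace G I) := NormedSpace.ofCore core

/-- `v ∈ L^G` is the weak derivative of `u ∈ L^G` on `I`. -/
def HasDeriv (u v : OrliczSpace G I) : Prop :=
  HasWeakDerivOn u.toClass v.toClass I.carrier

theorem integrable (u : OrliczSpace G I) : Integrable u.toClass I.measure :=
  integrable_of_modular_lt G I u.modular_lt

theorem locallyIntegrableOn (u : OrliczSpace G I) :
    LocallyIntegrableOn u.toClass (interior I.carrier) :=
  (IntegrableOn.mono_set u.integrable interior_subset).locallyIntegrableOn

theorem integrable_smul {φ : ℝ → ℝ} (hφ : Continuous φ) (hc : HasCompactSupport φ)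
    (u : OrliczSpace G I) : Integrable (fun t => φ t • u.toClass t) I.measure := by
  obtain ⟨C, hC⟩ := hc.exists_bound_of_continuous hφ
  exact u.integrable.bdd_smul C hφ.aestronglyMeasurable (ae_of_all _ hC)

theorem integral_smul_add {φ : ℝ → ℝ} (hφ : Continuous φ) (hc : HasCompactSupport φ)
    (u v : OrliczSpace G I) :
    ∫ t in I.carrier, φ t • (u + v).toClass t =
      (∫ t in I.carrier, φ t • u.toClass t) + ∫ t in I.carrier, φ t • v.toClass t := by
  rw [← integral_add (integrable_smul hφ hc u) (integrable_smul hφ hc v)]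
  refine integral_congr_ae ?_
  rw [map_add]
  filter_upwards [AEEqFun.coeFn_add u.toClass v.toClass] with t ht
  rw [ht, Pi.add_apply, smul_add]

theorem integral_smul_smul (φ : ℝ → ℝ) (c : ℝ) (u : OrliczSpace G I) :
    ∫ t in I.carrier, φ t • (c • u).toClass t = c • ∫ t in I.carrier, φ t • u.toClass t := by
  rw [← integral_smul]
  refine integral_congr_ae ?_
  rw [map_smul]
  filter_upwards [AEEqFun.coeFn_smul c u.toClass] with t ht
  rw [ht, Pi.smul_apply, smul_comm]

theorem HasDeriv.add {u v u' v' : OrliczSpace G I} (hu : HasDeriv u u') (hv : HasDeriv v v') :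
    HasDeriv (u + v) (u' + v') := by
  refine ⟨locallyIntegrableOn _, locallyIntegrableOn _, fun φ h1 h2 h3 => ?_⟩
  rw [integral_smul_add (h1.continuous_deriv (by simp)) h2.deriv,
    integral_smul_add h1.continuous h2, hu.2.2 φ h1 h2 h3, hv.2.2 φ h1 h2 h3, neg_add]

theorem HasDeriv.smul {u u' : OrliczSpace G I} (c : ℝ) (hu : HasDeriv u u') :
    HasDeriv (c • u) (c • u') := by
  refine ⟨locallyIntegrableOn _, locallyIntegrableOn _, fun φ h1 h2 h3 => ?_⟩
  rw [integral_smul_smul, integral_smul_smul, hu.2.2 φ h1 h2 h3, smul_neg]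

theorem HasDeriv.zero : HasDeriv (0 : OrliczSpace G I) 0 := by
  refine ⟨locallyIntegrableOn _, locallyIntegrableOn _, fun φ _ _ _ => ?_⟩
  have h : ∀ ψ : ℝ → ℝ, ∫ t in I.carrier, ψ t • (0 : OrliczSpace G I).toClass t = 0 := fun ψ => by
    have := integral_smul_smul ψ 0 (0 : OrliczSpace G I)
    rwa [smul_zero, zero_smul] at this
  rw [h, h, neg_zero]

theorem HasDeriv.eq_zero {v : OrliczSpace G I} (h : HasDeriv 0 v) : v = 0 := by
  have hz : ∀ φ : ℝ → ℝ, ContDiff ℝ (⊤ : ℕ∞) φ → HasCompactSupport φ →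
      tsupport φ ⊆ interior I.carrier →
      ∫ t, φ t • v.toClass t ∂I.measure = 0 := fun φ h1 h2 h3 => by
    have e1 := h.2.2 φ h1 h2 h3
    have e2 := (HasDeriv.zero (G := G) (I := I)).2.2 φ h1 h2 h3
    have e3 := integral_smul_smul φ 0 (0 : OrliczSpace G I)
    rw [smul_zero, zero_smul] at e3
    rw [e2, e3, neg_zero] at e1
    exact neg_eq_zero.1 e1.symm
  have hae := isOpen_interior.ae_eq_zero_of_integral_contDiff_smul_eq_zero
    (v.integrable.locallyIntegrable.locallyIntegrableOn _) hz
  have hint : ∀ᵐ t ∂I.measure, t ∈ interior I.carrier := by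
    rw [ae_restrict_iff' I.ordConnected.measurableSet]
    have hf : volume (frontier I.carrier) = 0 :=
      I.ordConnected.convex.addHaar_frontier volume
    filter_upwards [measure_eq_zero_iff_ae_notMem.1 hf] with t ht hI
    by_contra hni
    exact ht ⟨subset_closure hI, hni⟩
  refine toClass_injective ?_
  rw [map_zero]
  refine AEEqFun.ext ?_
  filter_upwards [hae, hint, AEEqFun.coeFn_zero (α := ℝ) (μ := I.measure)
    (β := EuclideanSpace ℝ (Fin n))] with t h1 h2 h3
  rw [h3, h1 h2, Pi.zero_apply]

/-- Weak derivatives are unique. -/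
theorem HasDeriv.unique {u v w : OrliczSpace G I} (hv : HasDeriv u v) (hw : HasDeriv u w) :
    v = w := by
  have h := hv.add (hw.smul (-1))
  rw [neg_one_smul, neg_one_smul, add_neg_cancel, ← sub_eq_add_neg] at h
  exact sub_eq_zero.1 h.eq_zero

end OrliczSpace

/-- `{u ∈ L^G : u has a weak derivative in L^G}` as a linear subspace of `L^G(I, ℝⁿ)`. -/
def orliczSobolevSubmodule {n : ℕ} (G : GFunction n) (I : FiniteInterval) :
    Submodule ℝ (OrliczSpace G I) where
  carrier := {u | ∃ v : OrliczSpace G I, u.HasDeriv v}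
  add_mem' := fun ⟨v, hv⟩ ⟨w, hw⟩ => ⟨v + w, hv.add hw⟩
  zero_mem' := ⟨0, OrliczSpace.HasDeriv.zero⟩
  smul_mem' := fun c _ ⟨v, hv⟩ => ⟨c • v, hv.smul c⟩

/-- The Orlicz–Sobolev space `W¹L^G(I, ℝⁿ)`. It does not inherit the norm of `L^G`. -/
def OrliczSobolevSpace {n : ℕ} (G : GFunction n) (I : FiniteInterval) : Type :=
  ↥(orliczSobolevSubmodule G I)

namespace OrliczSobolevSpace

variable {n : ℕ} {G : GFunction n} {I : FiniteInterval}

instance : AddCommGroup (OrliczSobolevSpace G I) :=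
  inferInstanceAs (AddCommGroup (orliczSobolevSubmodule G I))

instance : Module ℝ (OrliczSobolevSpace G I) :=
  inferInstanceAs (Module ℝ (orliczSobolevSubmodule G I))

/-- The function `u ∈ L^G` itself. -/
def toOrlicz : OrliczSobolevSpace G I →ₗ[ℝ] OrliczSpace G I :=
  (orliczSobolevSubmodule G I).subtype

theorem exists_hasDeriv (u : OrliczSobolevSpace G I) : ∃ v, u.toOrlicz.HasDeriv v := u.2

/-- The weak derivative `u̇ ∈ L^G`. -/
def weakDeriv : OrliczSobolevSpace G I →ₗ[ℝ] OrliczSpace G I where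
  toFun u := u.exists_hasDeriv.choose
  map_add' u v := (u + v).exists_hasDeriv.choose_spec.unique
    (by rw [map_add]; exact u.exists_hasDeriv.choose_spec.add v.exists_hasDeriv.choose_spec)
  map_smul' c u := (c • u).exists_hasDeriv.choose_spec.unique
    (by rw [map_smul]; exact u.exists_hasDeriv.choose_spec.smul c)

theorem hasDeriv_weakDeriv (u : OrliczSobolevSpace G I) : u.toOrlicz.HasDeriv (weakDeriv u) :=
  u.exists_hasDeriv.choose_spec

theorem toOrlicz_injective :
    Function.Injective (toOrlicz : OrliczSobolevSpace G I → OrliczSpace G I) :=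
  Subtype.val_injective

/-- The norm `‖u‖_G + ‖u̇‖_G`. -/
instance : Norm (OrliczSobolevSpace G I) := ⟨fun u => ‖u.toOrlicz‖ + ‖weakDeriv u‖⟩

theorem norm_def (u : OrliczSobolevSpace G I) : ‖u‖ = ‖u.toOrlicz‖ + ‖weakDeriv u‖ := rfl

theorem core : NormedSpace.Core ℝ (OrliczSobolevSpace G I) where
  norm_nonneg u := by rw [norm_def]; positivity
  norm_smul c u := by
    rw [norm_def, norm_def, map_smul, map_smul, norm_smul, norm_smul, mul_add]
  norm_triangle u v := by
    rw [norm_def, norm_def, norm_def, map_add, map_add]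
    linarith [norm_add_le u.toOrlicz v.toOrlicz, norm_add_le (weakDeriv u) (weakDeriv v)]
  norm_eq_zero_iff u := by
    refine ⟨fun h => toOrlicz_injective ?_, fun h => ?_⟩
    · rw [norm_def] at h
      rw [map_zero, ← norm_eq_zero]
      linarith [norm_nonneg u.toOrlicz, norm_nonneg (weakDeriv u)]
    · rw [h, norm_def, map_zero, map_zero, norm_zero, add_zero]

instance : NormedAddCommGroup (OrliczSobolevSpace G I) := NormedAddCommGroup.ofCore core

instance : NormedSpace ℝ (OrliczSobolevSpace G I) := NormedSpace.ofCore core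

end OrliczSobolevSpace

/-- A normed space is reflexive if the canonical map into its bidual is onto. -/
def IsReflexiveSpace (X : Type*) [NormedAddCommGroup X] [NormedSpace ℝ X] : Prop :=
  Function.Surjective (NormedSpace.inclusionInDoubleDual ℝ X)

end

/-! The map `u ↦ (u, u̇)` embeds `W¹L^G` into `L^G × L^G`, and its range, the graph of the weak
derivative, is closed because each test-function identity is continuous on `L^G`. Reflexivity and
separability pass to closed subspaces of finite products, and completeness follows from reflexivity,
so everything reduces to `L^G` itself.

Both growth conditions serve to make norms absolutely continuous. By `Δ₂` every multiple of `u ∈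
L^G` has finite modular, so dominated convergence gives `‖u 1_{A_k}‖ → 0` as the sets `A_k` vanish
(`tendsto_cut`), and bounded functions are dense in `L^G`. By `∇₂` the same holds for each
functional `F` on `L^G` (`exists_norm_comp_cut_le`): otherwise disjoint blocks of modular at most
`1` could be added so that `F` grows linearly in their number while the norm grows sublinearly.

Functionals are represented through Radon–Nikodym (`IsBoundedlyContinuous.exists_density`). A
functional `F` on `L^G` has a density on bounded functions, and truncating it shows that pairings
with bounded functions are dense in the dual (`denseRange_pairing`). An element `Φ` of the bidual,
restricted to these pairings, has a density `g` as well. The truncations of `g` have norm at most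
`‖Φ‖`, Fatou's lemma puts `g` in `L^G`, and `Φ` is evaluation at `g` by density. Separability comes
from `L¹`, whose topology agrees with that of `L^G` on bounded subsets of `L^∞`. -/

open scoped Topology

/-! ### Reflexivity of products and closed subspaces; completeness -/

section Reflexive

variable {X Y Z : Type*} [NormedAddCommGroup X] [NormedSpace ℝ X] [NormedAddCommGroup Y]
  [NormedSpace ℝ Y] [NormedAddCommGroup Z] [NormedSpace ℝ Z]

theorem isReflexiveSpace_iff :
    IsReflexiveSpace X ↔ ∀ Φ : StrongDual ℝ (StrongDual ℝ X), ∃ x : X, ∀ f, Φ f = f x := by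
  refine forall_congr' fun Φ => exists_congr fun x => ?_
  rw [ContinuousLinearMap.ext_iff]
  exact forall_congr' fun f => by rw [NormedSpace.dual_def, eq_comm]

/-- Each functional on the product is the sum of its restrictions to the two factors, so `Φ` is
determined by the elements it induces on the two biduals. -/
theorem IsReflexiveSpace.prod (hX : IsReflexiveSpace X) (hY : IsReflexiveSpace Y) :
    IsReflexiveSpace (X × Y) := by
  rw [isReflexiveSpace_iff] at *
  intro Φ
  obtain ⟨x, hx⟩ := hX (Φ.comp ((ContinuousLinearMap.compL ℝ (X × Y) X ℝ).flip
    (ContinuousLinearMap.fst ℝ X Y)))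
  obtain ⟨y, hy⟩ := hY (Φ.comp ((ContinuousLinearMap.compL ℝ (X × Y) Y ℝ).flip
    (ContinuousLinearMap.snd ℝ X Y)))
  refine ⟨(x, y), fun f => ?_⟩
  have h1 := hx (f.comp (ContinuousLinearMap.inl ℝ X Y))
  have h2 := hy (f.comp (ContinuousLinearMap.inr ℝ X Y))
  simp only [ContinuousLinearMap.comp_apply, ContinuousLinearMap.flip_apply,
    ContinuousLinearMap.compL_apply, ContinuousLinearMap.inl_apply,
    ContinuousLinearMap.inr_apply] at h1 h2
  have e : f = (f.comp (ContinuousLinearMap.inl ℝ X Y)).comp (ContinuousLinearMap.fst ℝ X Y) +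
      (f.comp (ContinuousLinearMap.inr ℝ X Y)).comp (ContinuousLinearMap.snd ℝ X Y) := by
    refine ContinuousLinearMap.ext fun p => ?_
    simp [← map_add]
  have e2 : f (x, y) = f (x, 0) + f (0, y) := by rw [← map_add]; simp
  rw [e2, ← h1, ← h2, ← map_add, ← e]

/-- A point outside a closed subspace is separated from it by a functional vanishing on it. -/
theorem exists_strongDual_eq_zero_of_notMem {S : Submodule ℝ Y} (hS : IsClosed (S : Set Y)) {y : Y}
    (hy : y ∉ S) : ∃ f : StrongDual ℝ Y, (∀ s ∈ S, f s = 0) ∧ f y ≠ 0 := by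
  obtain ⟨f, c, h1, h2⟩ := geometric_hahn_banach_closed_point S.convex hS hy
  have hz : ∀ s ∈ S, f s = 0 := by
    intro s hs
    by_contra h
    -- A multiple of `s` at which `f` equals `c + 1` contradicts the bound `f < c` on the subspace.
    have h3 := h1 (((c + 1) / f s) • s) (S.smul_mem _ hs)
    rw [map_smul, smul_eq_mul, div_mul_cancel₀ _ h] at h3
    linarith
  have h0 := h1 0 S.zero_mem
  rw [map_zero] at h0
  exact ⟨f, hz, (h0.trans h2).ne'⟩

/-- A space that embeds into a reflexive space with closed range is reflexive. -/
theorem IsReflexiveSpace.of_antilipschitz (hY : IsReflexiveSpace Y) (J : Z →L[ℝ] Y)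
    {K : NNReal} (hJ : AntilipschitzWith K J) (hr : IsClosed (range J)) : IsReflexiveSpace Z := by
  rw [isReflexiveSpace_iff] at *
  intro Φ
  obtain ⟨y, hy⟩ := hY (Φ.comp ((ContinuousLinearMap.compL ℝ Z Y ℝ).flip J))
  simp only [ContinuousLinearMap.comp_apply, ContinuousLinearMap.flip_apply,
    ContinuousLinearMap.compL_apply] at hy
  -- A functional `f` vanishing on the range has `f.comp J = 0`, hence `f y = Φ 0 = 0`; Hahn–Banach
  -- separation then leaves `y` no place outside the range.
  have hmem : y ∈ LinearMap.range (J : Z →ₗ[ℝ] Y) := by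
    by_contra hn
    obtain ⟨f, hf, hfy⟩ := exists_strongDual_eq_zero_of_notMem
      (S := LinearMap.range (J : Z →ₗ[ℝ] Y)) hr hn
    refine hfy ?_
    have : f.comp J = 0 := by
      ext z
      exact hf _ ⟨z, rfl⟩
    rw [← hy f, this, map_zero]
  obtain ⟨z, rfl⟩ := hmem
  refine ⟨z, fun g => ?_⟩
  let e := LinearEquiv.ofInjective (J : Z →ₗ[ℝ] Y) hJ.injective
  have he : ∀ w, J (e.symm w) = w := fun w =>
    congrArg Subtype.val (e.apply_symm_apply w)
  -- `g ∘ J⁻¹` is bounded on the range by the antilipschitz estimate; its Hahn–Banach extension `f`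
  -- satisfies `f.comp J = g`, so what is known for functionals on `Y` reaches every `g`.
  let g' : StrongDual ℝ (LinearMap.range (J : Z →ₗ[ℝ] Y)) :=
    LinearMap.mkContinuous ((g : Z →ₗ[ℝ] ℝ).comp e.symm.toLinearMap) (‖g‖ * K) fun w => by
      refine (g.le_opNorm _).trans ?_
      rw [mul_assoc]
      refine mul_le_mul_of_nonneg_left ?_ (norm_nonneg _)
      have := hJ.le_mul_norm (map_zero J) (e.symm w)
      rwa [he] at this
  obtain ⟨f, hf, -⟩ := exists_extension_norm_eq _ g'
  have hfg : f.comp J = g := by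
    ext z
    have := hf (e z)
    refine this.trans ?_
    change g (e.symm (e z)) = g z
    rw [e.symm_apply_apply]
  have := hy f
  rw [hfg] at this
  exact this.trans (DFunLike.congr_fun hfg z)

/-- A reflexive space is isometric to its bidual, and dual spaces are complete. -/
theorem IsReflexiveSpace.completeSpace (hX : IsReflexiveSpace X) : CompleteSpace X :=
  (IsometryEquiv.mk' _ _ (Function.rightInverse_surjInv hX)
    (NormedSpace.inclusionInDoubleDualLi ℝ (E := X)).isometry).completeSpace

end Reflexive

/-! ### Functionals on bounded measurable functions and their densities -/

section BoundedMeasurable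

/-- Bounded strongly measurable functions. -/
def boundedMeasurable (α E : Type*) [MeasurableSpace α] [NormedAddCommGroup E] [NormedSpace ℝ E] :
    Submodule ℝ (α → E) where
  carrier := {f | StronglyMeasurable f ∧ ∃ C, ∀ x, ‖f x‖ ≤ C}
  add_mem' := fun ⟨hf, C, hC⟩ ⟨hg, D, hD⟩ =>
    ⟨hf.add hg, C + D, fun x => (norm_add_le _ _).trans (add_le_add (hC x) (hD x))⟩
  zero_mem' := ⟨stronglyMeasurable_zero, 0, fun x => by simp⟩
  smul_mem' := fun c f ⟨hf, C, hC⟩ => ⟨hf.const_smul c, ‖c‖ * C, fun x => by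
    rw [Pi.smul_apply, norm_smul]
    exact mul_le_mul_of_nonneg_left (hC x) (norm_nonneg _)⟩

variable {α E : Type*} [MeasurableSpace α] [NormedAddCommGroup E] [NormedSpace ℝ E]

namespace boundedMeasurable

instance : CoeFun (boundedMeasurable α E) (fun _ => α → E) := ⟨Subtype.val⟩

theorem stronglyMeasurable (f : boundedMeasurable α E) : StronglyMeasurable f := f.2.1

theorem exists_bound (f : boundedMeasurable α E) : ∃ C, ∀ x, ‖f x‖ ≤ C := f.2.2

theorem integrable (μ : Measure α) [IsFiniteMeasure μ] (f : boundedMeasurable α E) :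
    Integrable f μ := by
  obtain ⟨C, hC⟩ := exists_bound f
  exact Integrable.of_bound (stronglyMeasurable f).aestronglyMeasurable C (ae_of_all _ hC)

/-- The function equal to `c` on `A` and to `0` elsewhere. -/
noncomputable def indicatorConst {A : Set α} (hA : MeasurableSet A) (c : E) : boundedMeasurable α E :=
  ⟨A.indicator fun _ => c, stronglyMeasurable_const.indicator hA, ‖c‖, fun _ =>
    norm_indicator_le_norm_self (fun _ => c) _⟩

theorem indicatorConst_of_mem {A : Set α} (hA : MeasurableSet A) (c : E) {x : α} (hx : x ∈ A) :
    indicatorConst hA c x = c := indicator_of_mem hx (fun _ => c)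

theorem indicatorConst_of_notMem {A : Set α} (hA : MeasurableSet A) (c : E) {x : α} (hx : x ∉ A) :
    indicatorConst hA c x = 0 := indicator_of_notMem hx (fun _ => c)

/-- A simple function as a bounded function. -/
def ofSimpleFunc (s : SimpleFunc α E) : boundedMeasurable α E :=
  ⟨s, s.stronglyMeasurable, s.exists_forall_norm_le⟩

end boundedMeasurable

open boundedMeasurable

/-- Sequential continuity with respect to bounded almost everywhere convergence. -/
def IsBoundedlyContinuous (μ : Measure α) (L : boundedMeasurable α E →ₗ[ℝ] ℝ) : Prop :=
  ∀ w : ℕ → boundedMeasurable α E, (∀ k x, ‖w k x‖ ≤ 1) →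
    (∀ᵐ x ∂μ, Tendsto (fun k => w k x) atTop (𝓝 0)) → Tendsto (fun k => L (w k)) atTop (𝓝 0)

variable {μ : Measure α}

theorem IsBoundedlyContinuous.tendsto_zero {L : boundedMeasurable α E →ₗ[ℝ] ℝ}
    (hL : IsBoundedlyContinuous μ L) {C : ℝ} {w : ℕ → boundedMeasurable α E}
    (hC : ∀ k x, ‖w k x‖ ≤ C) (hw : ∀ᵐ x ∂μ, Tendsto (fun k => w k x) atTop (𝓝 0)) :
    Tendsto (fun k => L (w k)) atTop (𝓝 0) := by
  have hp : 0 < |C| + 1 := by positivity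
  have h := hL (fun k => (|C| + 1)⁻¹ • w k) (fun k x => ?_) ?_
  · have h2 := h.const_mul (|C| + 1)
    rw [mul_zero] at h2
    refine h2.congr fun k => ?_
    rw [map_smul, smul_eq_mul, mul_inv_cancel_left₀ hp.ne']
  · change ‖(|C| + 1)⁻¹ • w k x‖ ≤ 1
    rw [norm_smul, norm_inv, Real.norm_of_nonneg hp.le, inv_mul_le_iff₀ hp]
    linarith [hC k x, le_abs_self C]
  · filter_upwards [hw] with x hx
    simpa using hx.const_smul (|C| + 1)⁻¹

theorem IsBoundedlyContinuous.tendsto {L : boundedMeasurable α E →ₗ[ℝ] ℝ}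
    (hL : IsBoundedlyContinuous μ L) {C : ℝ} {w : ℕ → boundedMeasurable α E}
    {v : boundedMeasurable α E} (hC : ∀ k x, ‖w k x‖ ≤ C)
    (hw : ∀ᵐ x ∂μ, Tendsto (fun k => w k x) atTop (𝓝 (v x))) :
    Tendsto (fun k => L (w k)) atTop (𝓝 (L v)) := by
  obtain ⟨D, hD⟩ := exists_bound v
  have h := hL.tendsto_zero (C := C + D) (w := fun k => w k - v)
    (fun k x => (norm_sub_le (w k x) (v x)).trans (add_le_add (hC k x) (hD x))) ?_
  · simp only [map_sub] at h
    exact tendsto_sub_nhds_zero_iff.1 h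
  · filter_upwards [hw] with x hx
    exact tendsto_sub_nhds_zero_iff.2 hx

open Classical in
/-- The signed measure `A ↦ L (c 1_A)`. -/
noncomputable def IsBoundedlyContinuous.signedMeasure {L : boundedMeasurable α E →ₗ[ℝ] ℝ}
    (hL : IsBoundedlyContinuous μ L) (c : E) : SignedMeasure α where
  measureOf' A := if h : MeasurableSet A then L (indicatorConst h c) else 0
  empty' := by
    rw [dif_pos MeasurableSet.empty, ← map_zero L]
    congr 1
    exact Subtype.ext (indicator_empty _)
  not_measurable' A h := dif_neg h
  m_iUnion' A hA hd := by
    have hfin : ∀ s : Finset ℕ, (∑ i ∈ s, if h : MeasurableSet (A i) then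
        L (indicatorConst h c) else 0) =
        L (indicatorConst (s.measurableSet_biUnion fun i _ => hA i) c) := by
      intro s
      have : indicatorConst (s.measurableSet_biUnion fun i _ => hA i) c =
          ∑ i ∈ s, indicatorConst (hA i) c := by
        refine Subtype.ext ?_
        rw [AddSubmonoidClass.coe_finsetSum]
        funext x
        rw [Finset.sum_apply]
        exact Finset.indicator_biUnion_apply (f := fun _ => c) s A (fun i _ j _ hij => hd hij) x
      rw [this, map_sum]
      exact Finset.sum_congr rfl fun i _ => dif_pos (hA i)
    -- Unconditional summation is a limit along all finite sets, whereas the continuity of `L`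
    -- concerns sequences only. Sequences of finite sets tending to `atTop` suffice, since that
    -- filter is countably generated.
    have hsum : ∀ s : ℕ → Finset ℕ, Tendsto s atTop atTop →
        Tendsto (fun k => L (indicatorConst ((s k).measurableSet_biUnion fun i _ => hA i) c)) atTop
          (𝓝 (L (indicatorConst (MeasurableSet.iUnion hA) c))) := by
      intro s hs
      refine hL.tendsto (C := ‖c‖) (fun k x => norm_indicator_le_norm_self (fun _ => c) x) ?_
      refine ae_of_all _ fun x => ?_
      refine tendsto_const_nhds.congr' ?_
      by_cases hx : x ∈ ⋃ i, A i
      · obtain ⟨i, hi⟩ := mem_iUnion.1 hx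
        filter_upwards [hs.eventually_ge_atTop {i}] with k hk
        have : x ∈ ⋃ i ∈ s k, A i := mem_biUnion (by simpa using hk) hi
        exact (indicatorConst_of_mem _ c hx).trans (indicatorConst_of_mem _ c this).symm
      · refine Eventually.of_forall fun k => ?_
        have : x ∉ ⋃ i ∈ s k, A i := fun h => hx (iUnion₂_subset_iUnion _ _ h)
        exact (indicatorConst_of_notMem _ c hx).trans (indicatorConst_of_notMem _ c this).symm
    rw [dif_pos (MeasurableSet.iUnion hA), HasSum]
    simp only [SummationFilter.unconditional_filter, hfin]
    refine tendsto_of_seq_tendsto fun s hs => hsum s hs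

theorem IsBoundedlyContinuous.signedMeasure_apply {L : boundedMeasurable α E →ₗ[ℝ] ℝ}
    (hL : IsBoundedlyContinuous μ L) (c : E) {A : Set α} (hA : MeasurableSet A) :
    hL.signedMeasure c A = L (indicatorConst hA c) := dif_pos hA

theorem IsBoundedlyContinuous.exists_density_const [SigmaFinite μ]
    {L : boundedMeasurable α E →ₗ[ℝ] ℝ} (hL : IsBoundedlyContinuous μ L) (c : E) :
    ∃ g : α → ℝ, Measurable g ∧ Integrable g μ ∧ ∀ A (hA : MeasurableSet A),
      L (indicatorConst hA c) = ∫ x in A, g x ∂μ := by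
  have hac : hL.signedMeasure c ≪ᵥ μ.toENNRealVectorMeasure := by
    refine VectorMeasure.AbsolutelyContinuous.mk fun A hA h0 => ?_
    rw [Measure.toENNRealVectorMeasure_apply_measurable hA] at h0
    rw [hL.signedMeasure_apply c hA]
    -- The zero sequence converges almost everywhere to the indicator function of a null set, which
    -- forces `L` to vanish there.
    have h := hL.tendsto (C := 0) (w := fun _ => 0) (v := indicatorConst hA c)
      (fun k x => by simp) ?_
    · simpa using tendsto_nhds_unique h tendsto_const_nhds
    · filter_upwards [measure_eq_zero_iff_ae_notMem.1 h0] with x hx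
      exact by
        rw [indicatorConst_of_notMem hA c hx]
        exact tendsto_const_nhds
  refine ⟨(hL.signedMeasure c).rnDeriv μ, SignedMeasure.measurable_rnDeriv _ _,
    SignedMeasure.integrable_rnDeriv _ _, fun A hA => ?_⟩
  rw [← withDensityᵥ_apply (SignedMeasure.integrable_rnDeriv _ _) hA,
    SignedMeasure.withDensityᵥ_rnDeriv_eq _ _ hac, hL.signedMeasure_apply c hA]

/-- A functional on bounded functions that is continuous for bounded almost everywhere convergence
is given by an integrable density. -/
theorem IsBoundedlyContinuous.exists_density [IsFiniteMeasure μ] {n : ℕ}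
    {L : boundedMeasurable α (EuclideanSpace ℝ (Fin n)) →ₗ[ℝ] ℝ}
    (hL : IsBoundedlyContinuous μ L) :
    ∃ g : α → EuclideanSpace ℝ (Fin n), Measurable g ∧ Integrable g μ ∧
      ∀ w, L w = ∫ x, inner ℝ (g x) (w x) ∂μ := by
  choose γ hγm hγi hγ using fun i => hL.exists_density_const (EuclideanSpace.single i (1 : ℝ))
  let g : α → EuclideanSpace ℝ (Fin n) := fun x => ∑ i, γ i x • EuclideanSpace.single i (1 : ℝ)
  have hgi : Integrable g μ := integrable_finsetSum _ fun i _ => (hγi i).smul_const _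
  have hgm : Measurable g := Finset.measurable_sum _ fun i _ => (hγm i).smul_const _
  have hinner : ∀ w : boundedMeasurable α (EuclideanSpace ℝ (Fin n)),
      Integrable (fun x => inner ℝ (g x) (w x)) μ := by
    intro w
    obtain ⟨C, hC⟩ := exists_bound w
    refine (hgi.norm.mul_const C).mono' (hgi.aestronglyMeasurable.inner
      (stronglyMeasurable w).aestronglyMeasurable) (ae_of_all _ fun x => ?_)
    exact (norm_inner_le_norm _ _).trans (mul_le_mul_of_nonneg_left (hC x) (norm_nonneg _))
  have hcoord : ∀ x (c : EuclideanSpace ℝ (Fin n)), inner ℝ (g x) c = ∑ i, c i * γ i x := by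
    intro x c
    simp [g, sum_inner, inner_smul_left, EuclideanSpace.inner_single_left, mul_comm]
  have hind : ∀ (c : EuclideanSpace ℝ (Fin n)) A (hA : MeasurableSet A),
      L (indicatorConst hA c) = ∫ x, inner ℝ (g x) (indicatorConst hA c x) ∂μ := by
    intro c A hA
    have e : (indicatorConst hA c : boundedMeasurable α (EuclideanSpace ℝ (Fin n))) =
        ∑ i, c i • indicatorConst hA (EuclideanSpace.single i (1 : ℝ)) := by
      refine Subtype.ext ?_
      rw [AddSubmonoidClass.coe_finsetSum]
      funext x
      rw [Finset.sum_apply]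
      by_cases hx : x ∈ A
      · refine PiLp.ext fun j => ?_
        simp [indicatorConst, hx, Pi.single_apply]
      · simp [indicatorConst, hx]
    have e2 : ∀ x, inner ℝ (g x) (indicatorConst hA c x) =
        A.indicator (fun x => ∑ i, c i * γ i x) x := by
      intro x
      by_cases hx : x ∈ A
      · simp [indicatorConst, hx, hcoord]
      · simp [indicatorConst, hx]
    simp_rw [e2]
    rw [e, map_sum, integral_indicator hA,
      integral_finsetSum _ fun i _ => ((hγi i).const_mul _).integrableOn]
    refine Finset.sum_congr rfl fun i _ => ?_
    rw [map_smul, hγ, integral_const_mul, smul_eq_mul]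
  have hsimple : ∀ s : SimpleFunc α (EuclideanSpace ℝ (Fin n)),
      L (ofSimpleFunc s) = ∫ x, inner ℝ (g x) (s x) ∂μ := by
    intro s
    induction s using SimpleFunc.induction with
    | const c hA =>
      convert hind c _ hA using 2
      · refine Subtype.ext ?_
        funext x
        simp [ofSimpleFunc, indicatorConst, indicator, SimpleFunc.coe_piecewise]
      · funext x
        simp [indicatorConst, indicator, piecewise]
    | add hd h1 h2 =>
      rename_i s t
      have : ofSimpleFunc (s + t) = ofSimpleFunc s + ofSimpleFunc t := rfl
      rw [this, map_add, h1, h2]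
      refine (integral_add (hinner (ofSimpleFunc s)) (hinner (ofSimpleFunc t))).symm.trans ?_
      simp [inner_add_right, ofSimpleFunc]
  refine ⟨g, hgm, hgi, fun w => ?_⟩
  obtain ⟨C, hC⟩ := exists_bound w
  have hC' : ∀ x, ‖w x‖ ≤ |C| := fun x => (hC x).trans (le_abs_self C)
  -- Uniformly bounded simple approximations: `L` passes to the limit by bounded continuity, the
  -- integral by dominated convergence.
  let s := (stronglyMeasurable w).approxBounded |C|
  have hs : ∀ k x, ‖s k x‖ ≤ |C| := fun k x =>
    StronglyMeasurable.norm_approxBounded_le (stronglyMeasurable w) (abs_nonneg C) k x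
  have hlim : ∀ x, Tendsto (fun k => s k x) atTop (𝓝 (w x)) := fun x =>
    StronglyMeasurable.tendsto_approxBounded_of_norm_le (stronglyMeasurable w) (hC' x)
  have h1 : Tendsto (fun k => L (ofSimpleFunc (s k))) atTop (𝓝 (L w)) :=
    hL.tendsto (C := |C|) hs (ae_of_all _ hlim)
  have h2 : Tendsto (fun k => ∫ x, inner ℝ (g x) (s k x) ∂μ) atTop
      (𝓝 (∫ x, inner ℝ (g x) (w x) ∂μ)) := by
    refine tendsto_integral_of_dominated_convergence (fun x => ‖g x‖ * |C|)
      (fun k => (hinner (ofSimpleFunc (s k))).aestronglyMeasurable) (hgi.norm.mul_const _)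
      (fun k => ae_of_all _ fun x => ?_) (ae_of_all _ fun x => ?_)
    · exact (norm_inner_le_norm _ _).trans (mul_le_mul_of_nonneg_left (hs k x) (norm_nonneg _))
    · exact tendsto_const_nhds.inner (hlim x)
  simp_rw [hsimple] at h1
  exact tendsto_nhds_unique h1 h2

end BoundedMeasurable

/-! ### Growth estimates for `G` -/

namespace GFunction

variable {n : ℕ} (G : GFunction n)

theorem exists_bound_of_norm_le (M : ℝ) : ∃ C : ℝ, 0 < C ∧ ∀ x, ‖x‖ ≤ M → G x ≤ C := by
  obtain ⟨C, hC⟩ := (isCompact_closedBall (0 : EuclideanSpace ℝ (Fin n)) M).exists_bound_of_continuousOn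
    G.continuous.continuousOn
  refine ⟨|C| + 1, by positivity, fun x hx => ?_⟩
  have := (le_abs_self _).trans (hC x (by simpa using hx))
  linarith [le_abs_self C]

/-- On a ball, a `G`-function is dominated by a multiple of the norm. -/
theorem exists_le_mul_norm (M : ℝ) : ∃ C : ℝ, 0 < C ∧ ∀ x, ‖x‖ ≤ M → G x ≤ C * ‖x‖ := by
  obtain ⟨C, hC0, hC⟩ := G.exists_bound_of_norm_le (|M| + 1)
  have hp : 0 < |M| + 1 := by positivity
  refine ⟨C / (|M| + 1), by positivity, fun x hx => ?_⟩
  rcases eq_or_ne x 0 with rfl | h0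
  · simp [G.map_zero]
  have hx0 : 0 < ‖x‖ := norm_pos_iff.2 h0
  -- Convexity along the ray through `x`, between `0` and the point of norm `|M| + 1`; this radius
  -- is positive whatever the sign of `M`.
  have h := G.smul_le (t := ‖x‖ / (|M| + 1)) (by positivity)
    ((div_le_one hp).2 (by linarith [le_abs_self M])) (((|M| + 1) / ‖x‖) • x)
  rw [smul_smul, div_mul_div_cancel₀ hp.ne', div_self hx0.ne', one_smul] at h
  have h2 := hC (((|M| + 1) / ‖x‖) • x) (by
    rw [norm_smul, Real.norm_of_nonneg (by positivity), div_mul_cancel₀ _ hx0.ne'])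
  calc G x ≤ ‖x‖ / (|M| + 1) * C := h.trans (mul_le_mul_of_nonneg_left h2 (by positivity))
    _ = _ := by ring

/-- Superlinear growth. -/
theorem norm_le_add_mul {ε : ℝ} (hε : 0 < ε) : ∃ R : ℝ, 0 ≤ R ∧ ∀ x, ‖x‖ ≤ R + ε * G x := by
  have h := G.supercoercive.eventually_ge_atTop ε⁻¹
  obtain ⟨R, -, hR⟩ := (Metric.hasBasis_cobounded_compl_closedBall
    (0 : EuclideanSpace ℝ (Fin n))).eventually_iff.1 h
  refine ⟨|R|, abs_nonneg _, fun x => ?_⟩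
  have hG := mul_nonneg hε.le (G.nonneg x)
  rcases le_or_gt ‖x‖ |R| with hx | hx
  · linarith
  · have h1 : ε⁻¹ ≤ G x / ‖x‖ := hR (x := x) (by simpa using (le_abs_self R).trans_lt hx)
    have hp : 0 < ‖x‖ := (abs_nonneg R).trans_lt hx
    rw [le_div_iff₀ hp, inv_mul_le_iff₀ hε] at h1
    linarith [abs_nonneg R]

/-- Iterated form of the `∇₂` condition. -/
theorem exists_iterate_nabla2 : ∃ K C : ℝ, 1 ≤ K ∧ 0 ≤ C ∧ ∀ (m : ℕ) x,
    G ((K ^ m)⁻¹ • x) ≤ ((2 * K) ^ m)⁻¹ * G x + C := by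
  obtain ⟨K, hK, M, -, h⟩ := G.nabla2
  obtain ⟨C, hC0, hC⟩ := G.exists_bound_of_norm_le M
  have hK0 : 0 < K := by linarith
  refine ⟨K, C, hK, hC0.le, fun m => ?_⟩
  induction m with
  | zero => intro x; simpa using hC0.le
  | succ m ih =>
    intro x
    have hn : 0 ≤ ((2 * K) ^ (m + 1))⁻¹ * G x := mul_nonneg (by positivity) (G.nonneg x)
    -- Inside the ball `G` is at most `C`; outside, `∇₂` applies once more. The earlier error is
    -- multiplied by `1 / (2 * K) ≤ 1`, so it does not accumulate.
    rcases le_total ‖(K ^ (m + 1))⁻¹ • x‖ M with hx | hx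
    · linarith [hC _ hx]
    · have h1 := h _ hx
      rw [smul_smul, show K * (K ^ (m + 1))⁻¹ = (K ^ m)⁻¹ by field_simp; ring] at h1
      have h2 := mul_le_mul_of_nonneg_left (ih x) (show 0 ≤ 1 / (2 * K) by positivity)
      have h3 : 1 / (2 * K) * C ≤ C := by
        refine mul_le_of_le_one_left hC0.le ?_
        rw [div_le_one (by positivity)]
        linarith
      have e : 1 / (2 * K) * (((2 * K) ^ m)⁻¹ * G x + C) =
          ((2 * K) ^ (m + 1))⁻¹ * G x + 1 / (2 * K) * C := by
        rw [pow_succ]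
        field_simp
      linarith

end GFunction

/-! ### Cutting by sets; absolute continuity of the norms of `L^G` and its dual -/

namespace OrliczSpace

variable {n : ℕ} {G : GFunction n} {I : FiniteInterval}

theorem ext_ae {u v : OrliczSpace G I} (h : u.toClass =ᵐ[I.measure] v.toClass) : u = v :=
  toClass_injective (AEEqFun.ext h)

theorem coe_add (u v : OrliczSpace G I) :
    ∀ᵐ t ∂I.measure, (u + v).toClass t = u.toClass t + v.toClass t := by
  rw [map_add]
  exact AEEqFun.coeFn_add _ _

theorem coe_sub (u v : OrliczSpace G I) :
    ∀ᵐ t ∂I.measure, (u - v).toClass t = u.toClass t - v.toClass t := by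
  rw [map_sub]
  exact AEEqFun.coeFn_sub _ _

theorem coe_smul (c : ℝ) (u : OrliczSpace G I) :
    ∀ᵐ t ∂I.measure, (c • u).toClass t = c • u.toClass t := by
  rw [map_smul]
  exact AEEqFun.coeFn_smul _ _

theorem norm_le_of_modular_le_one {α : ℝ} (hα : 0 < α) {u : OrliczSpace G I}
    (h : modular G I (α⁻¹ • u.toClass) ≤ 1) : ‖u‖ ≤ α :=
  csInf_le (luxemburg_bddBelow G I _) ⟨hα, h⟩

/-- The strict inequality supplies an admissible constant below `α`, so attainment of the infimum
need not be discussed. -/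
theorem modular_le_one_of_norm_lt {α : ℝ} {u : OrliczSpace G I} (h : ‖u‖ < α) :
    modular G I (α⁻¹ • u.toClass) ≤ 1 := by
  obtain ⟨β, ⟨hβ, hβ1⟩, hβα⟩ := exists_lt_of_csInf_lt (luxemburg_set_nonempty G I u.modular_lt) h
  refine (modular_smul_mono G I ?_ _).trans hβ1
  rw [abs_of_pos (inv_pos.2 (hβ.trans hβα)), abs_of_pos (inv_pos.2 hβ)]
  exact inv_anti₀ hβ hβα.le

theorem norm_le_of_modular_le {D : ℝ} (hD : 1 ≤ D) {u : OrliczSpace G I}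
    (h : modular G I u.toClass ≤ ENNReal.ofReal D) : ‖u‖ ≤ D := by
  have hp : 0 < D := by linarith
  refine norm_le_of_modular_le_one hp ?_
  have h1 : D⁻¹ ≤ 1 := inv_le_one_of_one_le₀ hD
  have h2 := modular_convex G I (a := D⁻¹) (b := 1 - D⁻¹) (by positivity)
    (by linarith) (by ring) u.toClass 0
  rw [class_smul_zero, add_zero, modular_zero, mul_zero, add_zero] at h2
  refine h2.trans ((mul_le_mul_right h _).trans ?_)
  rw [← ENNReal.ofReal_mul (by positivity), inv_mul_cancel₀ hp.ne', ENNReal.ofReal_one]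

theorem norm_mono {u v : OrliczSpace G I}
    (h : ∀ c : ℝ, modular G I (c • u.toClass) ≤ modular G I (c • v.toClass)) : ‖u‖ ≤ ‖v‖ := by
  refine le_of_forall_gt_imp_ge_of_dense fun α hα => ?_
  exact norm_le_of_modular_le_one ((norm_nonneg v).trans_lt hα)
    ((h _).trans (modular_le_one_of_norm_lt hα))

/-- The element of `L^G` given by a function with finite modular. -/
noncomputable def mk (f : ℝ → EuclideanSpace ℝ (Fin n)) (hf : AEStronglyMeasurable f I.measure)
    (h : ∫⁻ t in I.carrier, ENNReal.ofReal (G (f t)) < ∞) : OrliczSpace G I :=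
  ⟨AEEqFun.mk f hf, by
    change modular G I _ < ∞
    rw [modular]
    refine (lintegral_congr_ae ?_).trans_lt h
    filter_upwards [AEEqFun.coeFn_mk f hf] with t ht
    rw [ht]⟩

theorem coe_mk {f : ℝ → EuclideanSpace ℝ (Fin n)} (hf : AEStronglyMeasurable f I.measure)
    (h : ∫⁻ t in I.carrier, ENNReal.ofReal (G (f t)) < ∞) :
    (mk f hf h : OrliczSpace G I).toClass =ᵐ[I.measure] f := AEEqFun.coeFn_mk f hf

theorem aemeasurable_apply_smul {f : ℝ → EuclideanSpace ℝ (Fin n)}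
    (hf : AEStronglyMeasurable f I.measure) (c : ℝ) :
    AEMeasurable (fun t => ENNReal.ofReal (G (c • f t))) I.measure :=
  (G.continuous.measurable.comp_aemeasurable (hf.aemeasurable.const_smul c)).ennreal_ofReal

theorem apply_smul_indicator_le (c : ℝ) (A : Set ℝ) (f : ℝ → EuclideanSpace ℝ (Fin n)) (t : ℝ) :
    G (c • A.indicator f t) ≤ G (c • f t) := by
  by_cases ht : t ∈ A
  · simp [ht]
  · simpa [ht, G.map_zero] using G.nonneg _

theorem lintegral_indicator_lt (A : Set ℝ) (u : OrliczSpace G I) :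
    ∫⁻ t in I.carrier, ENNReal.ofReal (G (A.indicator u.toClass t)) < ∞ := by
  refine (lintegral_mono fun t => ENNReal.ofReal_le_ofReal ?_).trans_lt u.modular_lt
  simpa using apply_smul_indicator_le (G := G) 1 A u.toClass t

/-- Multiplication by the indicator function of a measurable set, as a linear map. -/
noncomputable def cutₗ {A : Set ℝ} (hA : MeasurableSet A) : OrliczSpace G I →ₗ[ℝ] OrliczSpace G I where
  toFun u := mk (A.indicator u.toClass) (u.toClass.aestronglyMeasurable.indicator hA)
    (lintegral_indicator_lt A u)
  map_add' u v := by
    refine ext_ae ?_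
    filter_upwards [coe_mk _ (lintegral_indicator_lt (G := G) (I := I) A (u + v)),
      coe_add (mk _ _ (lintegral_indicator_lt A u)) (mk _ _ (lintegral_indicator_lt A v)),
      coe_mk _ (lintegral_indicator_lt A u), coe_mk _ (lintegral_indicator_lt A v),
      coe_add u v] with t h1 h2 h3 h4 h5
    rw [h1, h2, h3, h4]
    by_cases ht : t ∈ A <;> simp only [ht, indicator_of_mem, indicator_of_notMem, not_false_eq_true, h5, add_zero]
  map_smul' c u := by
    refine ext_ae ?_
    filter_upwards [coe_mk _ (lintegral_indicator_lt (G := G) (I := I) A (c • u)),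
      coe_smul c (mk _ _ (lintegral_indicator_lt A u)),
      coe_mk _ (lintegral_indicator_lt A u), coe_smul c u] with t h1 h2 h3 h4
    rw [h1, RingHom.id_apply, h2, h3]
    by_cases ht : t ∈ A <;> simp only [ht, indicator_of_mem, indicator_of_notMem, not_false_eq_true, h4, smul_zero]

theorem coe_cutₗ {A : Set ℝ} (hA : MeasurableSet A) (u : OrliczSpace G I) :
    (cutₗ hA u).toClass =ᵐ[I.measure] A.indicator u.toClass :=
  coe_mk _ (lintegral_indicator_lt A u)

theorem modular_smul_cutₗ {A : Set ℝ} (hA : MeasurableSet A) (c : ℝ) (u : OrliczSpace G I) :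
    modular G I (c • (cutₗ hA u).toClass) =
      ∫⁻ t in I.carrier, ENNReal.ofReal (G (c • A.indicator u.toClass t)) := by
  rw [modular_smul_eq]
  refine lintegral_congr_ae ?_
  filter_upwards [coe_cutₗ hA u] with t ht
  rw [ht]

theorem norm_cutₗ_le {A : Set ℝ} (hA : MeasurableSet A) (u : OrliczSpace G I) :
    ‖cutₗ hA u‖ ≤ ‖u‖ := by
  refine norm_mono fun c => ?_
  rw [modular_smul_cutₗ, modular_smul_eq]
  exact lintegral_mono fun t => ENNReal.ofReal_le_ofReal (apply_smul_indicator_le c A _ t)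

/-- Multiplication by the indicator function of a measurable set. -/
noncomputable def cut {A : Set ℝ} (hA : MeasurableSet A) : OrliczSpace G I →L[ℝ] OrliczSpace G I :=
  (cutₗ hA).mkContinuous 1 fun u => by rw [one_mul]; exact norm_cutₗ_le hA u

theorem coe_cut {A : Set ℝ} (hA : MeasurableSet A) (u : OrliczSpace G I) :
    (cut hA u).toClass =ᵐ[I.measure] A.indicator u.toClass := coe_cutₗ hA u

theorem norm_cut_le_one {A : Set ℝ} (hA : MeasurableSet A) :
    ‖(cut hA : OrliczSpace G I →L[ℝ] OrliczSpace G I)‖ ≤ 1 :=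
  LinearMap.mkContinuous_norm_le _ zero_le_one _

theorem cut_compl_add_cut {A : Set ℝ} (hA : MeasurableSet A) (u : OrliczSpace G I) :
    cut hA.compl u + cut hA u = u := by
  refine ext_ae ?_
  filter_upwards [coe_add (cut hA.compl u) (cut hA u), coe_cut hA.compl u, coe_cut hA u]
    with t h1 h2 h3
  rw [h1, h2, h3]
  by_cases ht : t ∈ A <;> simp [ht]

theorem cut_cut {A B : Set ℝ} (hA : MeasurableSet A) (hB : MeasurableSet B) (u : OrliczSpace G I) :
    cut hA (cut hB u) = cut (hA.inter hB) u := by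
  refine ext_ae ?_
  filter_upwards [coe_cut hA (cut hB u), coe_cut hB u, coe_cut (hA.inter hB) u] with t h1 h2 h3
  rw [h1, h3, ← indicator_indicator]
  by_cases ht : t ∈ A <;> simp [ht, h2]

/-- Absolute continuity of the Luxemburg norm. -/
theorem tendsto_cut {A : ℕ → Set ℝ} (hA : ∀ k, MeasurableSet (A k))
    (h : ∀ᵐ t ∂I.measure, ∀ᶠ k in atTop, t ∉ A k) (u : OrliczSpace G I) :
    Tendsto (fun k => cut (hA k) u) atTop (𝓝 0) := by
  rw [NormedAddGroup.tendsto_nhds_zero]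
  intro ε hε
  -- Smallness of the norm is tested by the modular at scale `ε / 2`. The dominating function `G (u
  -- / (ε / 2))` is integrable because of `Δ₂`.
  have hlim : Tendsto (fun k => ∫⁻ t in I.carrier,
      ENNReal.ofReal (G ((ε / 2)⁻¹ • (A k).indicator u.toClass t))) atTop (𝓝 0) := by
    have := tendsto_lintegral_of_dominated_convergence' (μ := I.measure) (f := fun _ => 0)
      (F := fun k t => ENNReal.ofReal (G ((ε / 2)⁻¹ • (A k).indicator u.toClass t)))
      (fun t => ENNReal.ofReal (G ((ε / 2)⁻¹ • u.toClass t)))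
      (fun k => aemeasurable_apply_smul
        (u.toClass.aestronglyMeasurable.indicator (hA k)) _)
      (fun k => ae_of_all _ fun t => ENNReal.ofReal_le_ofReal (apply_smul_indicator_le _ _ _ t))
      ?_ ?_
    · simpa using this
    · have := modular_smul_lt G I (ε / 2)⁻¹ u.modular_lt
      rw [modular_smul_eq] at this
      exact this.ne
    · filter_upwards [h] with t ht
      refine tendsto_const_nhds.congr' ?_
      filter_upwards [ht] with k hk
      simp [hk, G.map_zero]
  filter_upwards [hlim.eventually_lt_const zero_lt_one] with k hk
  refine (norm_le_of_modular_le_one (half_pos hε) ?_).trans_lt (half_lt_self hε)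
  refine le_of_eq_of_le ?_ hk.le
  exact modular_smul_cutₗ (hA k) _ u

/-- The two summands have disjoint supports, so at almost every point at most one of them
contributes; the part of `w` outside `A` is discarded. -/
theorem modular_add_cut {A : Set ℝ} (hA : MeasurableSet A) {u : OrliczSpace G I}
    (hu : cut hA u = 0) (w : OrliczSpace G I) :
    modular G I (u + cut hA w).toClass ≤ modular G I u.toClass + modular G I w.toClass := by
  rw [modular, modular, modular, ← lintegral_add_left' (aemeasurable_comp G I _)]
  refine lintegral_mono_ae ?_
  have h0 : ∀ᵐ t ∂I.measure, (cut hA u).toClass t = 0 := by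
    rw [hu, map_zero]
    exact AEEqFun.coeFn_zero
  filter_upwards [coe_add u (cut hA w), coe_cut hA w, coe_cut hA u, h0] with t h1 h2 h3 h4
  rw [h1, h2]
  by_cases ht : t ∈ A
  · rw [h4] at h3
    simp only [ht, indicator_of_mem] at h3
    rw [← h3]
    simp [ht]
  · simp [ht]

/-- Quantitative use of `∇₂`: modular `(2K)^m` costs only a norm of order `K^m`. After division of
`s` by `K^m`, the iterated condition leaves a modular of at most `1 + C * V`, with `V` the length of
the interval. -/
theorem norm_le_pow_of_modular_le (G : GFunction n) (I : FiniteInterval) : ∃ K D : ℝ, 1 ≤ K ∧ 0 ≤ D ∧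
    ∀ (m : ℕ) (s : OrliczSpace G I), modular G I s.toClass ≤ ENNReal.ofReal ((2 * K) ^ m) →
      ‖s‖ ≤ K ^ m * D := by
  obtain ⟨K, C, hK, hC, h⟩ := G.exists_iterate_nabla2
  set V := (I.measure univ).toReal with hV
  have hV0 : 0 ≤ V := ENNReal.toReal_nonneg
  have hK0 : 0 < K := by linarith
  refine ⟨K, 1 + C * V, hK, by positivity, fun m s hs => ?_⟩
  have hmod : modular G I ((K ^ m)⁻¹ • s).toClass ≤ ENNReal.ofReal (1 + C * V) := by
    rw [map_smul, modular_smul_eq]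
    calc ∫⁻ t in I.carrier, ENNReal.ofReal (G ((K ^ m)⁻¹ • s.toClass t))
        ≤ ∫⁻ t in I.carrier, (ENNReal.ofReal (((2 * K) ^ m)⁻¹) * ENNReal.ofReal (G (s.toClass t)) +
            ENNReal.ofReal C) := by
          refine lintegral_mono fun t => ?_
          rw [← ENNReal.ofReal_mul (by positivity),
            ← ENNReal.ofReal_add (mul_nonneg (by positivity) (G.nonneg _)) hC]
          exact ENNReal.ofReal_le_ofReal (h m _)
      _ = ENNReal.ofReal (((2 * K) ^ m)⁻¹) * modular G I s.toClass +
            ENNReal.ofReal C * I.measure univ := by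
          rw [lintegral_add_right _ measurable_const, lintegral_const,
            lintegral_const_mul' _ _ ENNReal.ofReal_ne_top, modular]
      _ ≤ ENNReal.ofReal (((2 * K) ^ m)⁻¹) * ENNReal.ofReal ((2 * K) ^ m) +
            ENNReal.ofReal C * ENNReal.ofReal V := by
          rw [hV, ENNReal.ofReal_toReal (measure_ne_top _ _)]
          gcongr
      _ = ENNReal.ofReal (1 + C * V) := by
          rw [← ENNReal.ofReal_mul (by positivity), ← ENNReal.ofReal_mul hC,
            inv_mul_cancel₀ (by positivity), ENNReal.ofReal_add zero_le_one (by positivity)]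
  have h1 := norm_le_of_modular_le (by nlinarith [mul_nonneg hC hV0]) hmod
  rw [norm_smul, norm_inv, Real.norm_of_nonneg (by positivity),
    inv_mul_le_iff₀ (by positivity)] at h1
  exact h1

/-- The norm of the dual of `L^G` is absolutely continuous. -/
theorem exists_norm_comp_cut_le (F : StrongDual ℝ (OrliczSpace G I)) {A : ℕ → Set ℝ}
    (hA : ∀ k, MeasurableSet (A k)) (hanti : Antitone A)
    (h : ∀ᵐ t ∂I.measure, ∀ᶠ k in atTop, t ∉ A k) {ε : ℝ} (hε : 0 < ε) :
    ∃ j, ‖F.comp (cut (hA j))‖ ≤ ε := by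
  by_contra! hcon
  -- Gliding hump: since `F` stays large on every `A j`, and `F (cut (hA m) w) → 0` for fixed `w`, a
  -- block `A j \ A m` already carries a value of at least `ε`.
  have step : ∀ j, ∃ w : OrliczSpace G I, modular G I w.toClass ≤ 1 ∧
      ∃ m, ∃ hm : A m ⊆ A j, ε ≤ F (cut ((hA j).diff (hA m)) w) := by
    intro j
    obtain ⟨w, hw1, hw⟩ : ∃ w : OrliczSpace G I, ‖w‖ < 1 ∧ ε < F (cut (hA j) w) := by
      obtain ⟨w, hw1, hw⟩ := ContinuousLinearMap.exists_lt_apply_of_lt_opNorm _ (hcon j)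
      rw [Real.norm_eq_abs] at hw
      rcases lt_abs.1 hw with hw | hw
      · exact ⟨w, hw1, hw⟩
      · exact ⟨-w, by rwa [norm_neg], by simpa using hw⟩
    have hmod : modular G I w.toClass ≤ 1 := by simpa using modular_le_one_of_norm_lt hw1
    have hlim : Tendsto (fun m => F (cut (hA j) w) - F (cut (hA m) w)) atTop
        (𝓝 (F (cut (hA j) w) - F 0)) :=
      tendsto_const_nhds.sub ((F.continuous.tendsto 0).comp (tendsto_cut hA h w))
    rw [map_zero, sub_zero] at hlim
    obtain ⟨m, hm, hjm⟩ := ((hlim.eventually_const_lt hw).and (eventually_ge_atTop j)).exists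
    refine ⟨w, hmod, m, hanti hjm, ?_⟩
    have e : cut ((hA j).diff (hA m)) w = cut (hA j) w - cut (hA m) w := by
      have := cut_compl_add_cut (hA m) (cut (hA j) w)
      rw [cut_cut, cut_cut] at this
      rw [← this]
      have e1 : A m ∩ A j = A m := inter_eq_left.2 (hanti hjm)
      have e2 : (A m)ᶜ ∩ A j = A j \ A m := by rw [inter_comm, sdiff_eq]
      simp only [e1, e2, add_sub_cancel_right]
    rw [e, map_sub]
    exact hm.le
  -- Stacking `N` disjoint blocks. The partial sum vanishes on `A j`, which leaves room there for
  -- the next block.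
  have sums : ∀ N : ℕ, ∃ j, ∃ s : OrliczSpace G I, cut (hA j) s = 0 ∧
      modular G I s.toClass ≤ N ∧ N * ε ≤ F s := by
    intro N
    induction N with
    | zero => exact ⟨0, 0, by simp, by simp [modular_zero], by simp⟩
    | succ N ih =>
      obtain ⟨j, s, hs0, hs1, hs2⟩ := ih
      obtain ⟨w, hw, m, hm, hF⟩ := step j
      have hd : cut ((hA j).diff (hA m)) s = 0 := by
        have := cut_cut ((hA j).diff (hA m)) (hA j) s
        rw [hs0, map_zero] at this
        simpa only [inter_eq_left.2 (sdiff_subset : A j \ A m ⊆ A j)] using this.symm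
      refine ⟨m, s + cut ((hA j).diff (hA m)) w, ?_, ?_, ?_⟩
      · have e1 : cut (hA m) s = 0 := by
          have := cut_cut (hA m) (hA j) s
          rw [hs0, map_zero] at this
          simpa only [inter_eq_left.2 hm] using this.symm
        rw [map_add, e1, zero_add, cut_cut]
        refine ext_ae ?_
        filter_upwards [coe_cut ((hA m).inter ((hA j).diff (hA m))) w,
          (AEEqFun.coeFn_zero : ((0 : MeasurableClass n I) : ℝ → _) =ᵐ[I.measure] 0)] with t h1 h2
        rw [h1, map_zero, h2]
        simp
      · refine (modular_add_cut _ hd w).trans ?_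
        push_cast
        exact add_le_add hs1 hw
      · rw [map_add]
        push_cast
        linarith
  obtain ⟨K, D, hK, hD, hn⟩ := norm_le_pow_of_modular_le G I
  have hK0 : 0 < K := by linarith
  -- With about `(2K)^m` blocks, `F` is of order `(2K)^m * ε` while the norm is at most `K^m * D`;
  -- cancelling `K^m` bounds `2^m`, which is absurd. The factor `2` on the right absorbs the
  -- rounding by the floor.
  have key : ∀ m : ℕ, (2 : ℝ) ^ m * ε ≤ 2 * (‖F‖ * D) := by
    intro m
    obtain ⟨-, s, -, hs1, hs2⟩ := sums ⌊(2 * K) ^ m⌋₊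
    have h1 : (1 : ℝ) ≤ (2 * K) ^ m := one_le_pow₀ (by linarith)
    have h2 := Nat.lt_floor_add_one ((2 * K) ^ m)
    have h3 : (1 : ℝ) ≤ ⌊(2 * K) ^ m⌋₊ := by exact_mod_cast Nat.floor_pos.2 h1
    have h4 : ‖s‖ ≤ K ^ m * D := by
      refine hn m s (hs1.trans ?_)
      rw [← ENNReal.ofReal_natCast]
      exact ENNReal.ofReal_le_ofReal (Nat.floor_le (by positivity))
    have h5 : F s ≤ ‖F‖ * (K ^ m * D) := (le_abs_self _).trans
      ((F.le_opNorm s).trans (mul_le_mul_of_nonneg_left h4 (norm_nonneg _)))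
    have h6 : (2 * K) ^ m * ε ≤ 2 * (‖F‖ * (K ^ m * D)) := by nlinarith
    rw [mul_pow] at h6
    refine le_of_mul_le_mul_right (a := K ^ m) ?_ (by positivity)
    linarith
  obtain ⟨m, hm⟩ := pow_unbounded_of_one_lt (2 * (‖F‖ * D) / ε) (one_lt_two : (1 : ℝ) < 2)
  rw [div_lt_iff₀ hε] at hm
  linarith [key m]

end OrliczSpace

/-! ### Restriction and truncation of functions -/

namespace boundedMeasurable

variable {α E : Type*} [MeasurableSpace α] [NormedAddCommGroup E] [NormedSpace ℝ E]

/-- Multiplication of a bounded function by the indicator function of a measurable set. -/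
noncomputable def restrict {A : Set α} (hA : MeasurableSet A) (w : boundedMeasurable α E) :
    boundedMeasurable α E :=
  ⟨A.indicator w, (stronglyMeasurable w).indicator hA, by
    obtain ⟨C, hC⟩ := exists_bound w
    exact ⟨C, fun x => (norm_indicator_le_norm_self w x).trans (hC x)⟩⟩

theorem coe_restrict {A : Set α} (hA : MeasurableSet A) (w : boundedMeasurable α E) (x : α) :
    restrict hA w x = A.indicator w x := rfl

end boundedMeasurable

section Truncation

variable {α E : Type*} [NormedAddCommGroup E] {g : α → E}

/-- The set where `k < ‖g‖`. -/
def superlevel (g : α → E) (k : ℕ) : Set α := {x | k < ‖g x‖}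

theorem measurableSet_superlevel [MeasurableSpace α] (hg : StronglyMeasurable g) (k : ℕ) :
    MeasurableSet (superlevel g k) :=
  measurableSet_lt measurable_const hg.norm.measurable

theorem superlevel_antitone (g : α → E) : Antitone (superlevel g) := fun j k h x (hx : k < ‖g x‖) =>
  show (j : ℝ) < ‖g x‖ from lt_of_le_of_lt (Nat.cast_le.2 h) hx

theorem eventually_notMem_superlevel (g : α → E) (x : α) :
    ∀ᶠ k in atTop, x ∉ superlevel g k := by
  filter_upwards [(tendsto_natCast_atTop_atTop (R := ℝ)).eventually_ge_atTop ‖g x‖] with k hk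
  exact not_lt.2 hk

variable [MeasurableSpace α] [NormedSpace ℝ E]

/-- The function equal to `g` where `‖g‖ ≤ k` and to `0` elsewhere. -/
noncomputable def truncate (hg : StronglyMeasurable g) (k : ℕ) : boundedMeasurable α E :=
  ⟨(superlevel g k)ᶜ.indicator g, hg.indicator (measurableSet_superlevel hg k).compl, k, fun x => by
    by_cases hx : x ∈ (superlevel g k)ᶜ
    · rw [indicator_of_mem hx]
      exact not_lt.1 hx
    · rw [indicator_of_notMem hx, norm_zero]
      exact Nat.cast_nonneg k⟩

theorem coe_truncate (hg : StronglyMeasurable g) (k : ℕ) (x : α) :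
    truncate hg k x = (superlevel g k)ᶜ.indicator g x := rfl

end Truncation

theorem inner_indicator_left_eq {α : Type*} {n : ℕ} (A : Set α) (f g : α → EuclideanSpace ℝ (Fin n))
    (x : α) : inner ℝ (A.indicator f x) (g x) = inner ℝ (f x) (A.indicator g x) := by
  by_cases hx : x ∈ A <;> simp [hx]

/-! ### Bounded functions in `L^G` and in its dual; reflexivity of `L^G` -/

namespace OrliczSpace

open boundedMeasurable

variable {n : ℕ} {G : GFunction n} {I : FiniteInterval}

/-- Supercoercivity makes the unit ball equi-integrable: for `α > ‖u‖` one has `‖u‖ ≤ α (R + ε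
G(u/α))` pointwise, and the last term integrates to at most `ε`. The weight `φ = 1` gives the
embedding into `L¹`; weights small in `L¹` give small functionals. -/
theorem integral_mul_norm_le (G : GFunction n) (I : FiniteInterval) {ε : ℝ} (hε : 0 < ε) :
    ∃ R : ℝ, 0 ≤ R ∧ ∀ φ : ℝ → ℝ, AEStronglyMeasurable φ I.measure → (∀ t, 0 ≤ φ t) →
      (∀ t, φ t ≤ 1) → ∀ u : OrliczSpace G I,
      ∫ t in I.carrier, φ t * ‖u.toClass t‖ ≤ (ε + R * ∫ t in I.carrier, φ t) * ‖u‖ := by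
  obtain ⟨R, hR0, hR⟩ := G.norm_le_add_mul hε
  refine ⟨R, hR0, fun φ hφ h0 h1 u => ?_⟩
  have hφi : Integrable φ I.measure := Integrable.of_bound hφ 1 (ae_of_all _ fun t => by
    rw [Real.norm_of_nonneg (h0 t)]
    exact h1 t)
  have hc : 0 < ε + R * ∫ t in I.carrier, φ t :=
    add_pos_of_pos_of_nonneg hε (mul_nonneg hR0 (integral_nonneg h0))
  rw [mul_comm, ← div_le_iff₀ hc]
  refine le_of_forall_gt_imp_ge_of_dense fun α hα => ?_
  have hα0 : 0 < α := (norm_nonneg u).trans_lt hα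
  have hmod := modular_le_one_of_norm_lt hα
  rw [modular_smul_eq] at hmod
  have hGm : AEStronglyMeasurable (fun t => G (α⁻¹ • u.toClass t)) I.measure :=
    G.continuous.comp_aestronglyMeasurable (u.toClass.aestronglyMeasurable.fun_const_smul _)
  have hG0 : ∀ t, 0 ≤ G (α⁻¹ • u.toClass t) := fun t => G.nonneg _
  have hGi : Integrable (fun t => G (α⁻¹ • u.toClass t)) I.measure := by
    refine ⟨hGm, ?_⟩
    rw [hasFiniteIntegral_iff_ofReal (ae_of_all _ hG0)]
    exact hmod.trans_lt ENNReal.one_lt_top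
  have hG1 : ∫ t in I.carrier, G (α⁻¹ • u.toClass t) ≤ 1 := by
    rw [integral_eq_lintegral_of_nonneg_ae (ae_of_all _ hG0) hGm]
    exact ENNReal.toReal_le_of_le_ofReal zero_le_one (by simpa using hmod)
  rw [div_le_iff₀ hc]
  calc ∫ t in I.carrier, φ t * ‖u.toClass t‖
      ≤ ∫ t in I.carrier, α * (R * φ t + ε * G (α⁻¹ • u.toClass t)) := by
        refine integral_mono (Integrable.bdd_mul (c := 1) u.integrable.norm hφ (ae_of_all _ fun t => by
          rw [Real.norm_of_nonneg (h0 t)]; exact h1 t))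
          (((hφi.const_mul R).add (hGi.const_mul ε)).const_mul α) fun t => ?_
        have h2 := hR (α⁻¹ • u.toClass t)
        rw [norm_smul, norm_inv, Real.norm_of_nonneg hα0.le, inv_mul_le_iff₀ hα0] at h2
        have h3 := mul_le_mul_of_nonneg_left h2 (h0 t)
        have h4 : φ t * (α * (ε * G (α⁻¹ • u.toClass t))) ≤ α * (ε * G (α⁻¹ • u.toClass t)) :=
          mul_le_of_le_one_left (mul_nonneg hα0.le (mul_nonneg hε.le (hG0 t))) (h1 t)
        change φ t * ‖u.toClass t‖ ≤ α * (R * φ t + ε * G (α⁻¹ • u.toClass t))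
        linarith
    _ = α * (R * (∫ t in I.carrier, φ t) + ε * ∫ t in I.carrier, G (α⁻¹ • u.toClass t)) := by
        rw [integral_const_mul, integral_add (hφi.const_mul R) (hGi.const_mul ε),
          integral_const_mul, integral_const_mul]
    _ ≤ α * (ε + R * ∫ t in I.carrier, φ t) := by
        refine mul_le_mul_of_nonneg_left ?_ hα0.le
        have := mul_le_mul_of_nonneg_left hG1 hε.le
        linarith

/-- `L^G` embeds continuously into `L¹`. -/
theorem integral_norm_le (G : GFunction n) (I : FiniteInterval) : ∃ c : ℝ, 0 ≤ c ∧
    ∀ u : OrliczSpace G I, ∫ t in I.carrier, ‖u.toClass t‖ ≤ c * ‖u‖ := by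
  obtain ⟨R, hR0, hR⟩ := integral_mul_norm_le G I one_pos
  refine ⟨1 + R * ∫ t in I.carrier, (1 : ℝ), ?_, fun u => ?_⟩
  · have : 0 ≤ ∫ t in I.carrier, (1 : ℝ) := integral_nonneg fun _ => zero_le_one
    positivity
  · simpa only [one_mul] using hR (fun _ => 1) aestronglyMeasurable_const
      (fun _ => zero_le_one) (fun _ => le_rfl) u

/-- On bounded sets of `L^∞`, convergence in `L¹` implies convergence in `L^G`. -/
theorem norm_le_of_integral_norm_le (G : GFunction n) (I : FiniteInterval) (M : ℝ) {ε : ℝ}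
    (hε : 0 < ε) : ∃ δ : ℝ, 0 < δ ∧ ∀ u : OrliczSpace G I,
      (∀ᵐ t ∂I.measure, ‖u.toClass t‖ ≤ M) → ∫ t in I.carrier, ‖u.toClass t‖ ≤ δ → ‖u‖ ≤ ε := by
  -- The function `u / ε` takes values in the ball of radius `M / ε`, where `G` is at most `C` times
  -- the norm; `δ = ε / C` then makes its modular at most `1`.
  obtain ⟨C, hC0, hC⟩ := G.exists_le_mul_norm (ε⁻¹ * M)
  refine ⟨ε / C, by positivity, fun u hu hδ => norm_le_of_modular_le_one hε ?_⟩
  rw [modular_smul_eq]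
  calc ∫⁻ t in I.carrier, ENNReal.ofReal (G (ε⁻¹ • u.toClass t))
      ≤ ∫⁻ t in I.carrier, ENNReal.ofReal (C * ε⁻¹ * ‖u.toClass t‖) := by
        refine lintegral_mono_ae ?_
        filter_upwards [hu] with t ht
        refine ENNReal.ofReal_le_ofReal ?_
        have e : ‖ε⁻¹ • u.toClass t‖ = ε⁻¹ * ‖u.toClass t‖ := by
          rw [norm_smul, norm_inv, Real.norm_of_nonneg hε.le]
        refine (hC _ ?_).trans_eq (by rw [e, mul_assoc])
        rw [e]
        exact mul_le_mul_of_nonneg_left ht (by positivity)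
    _ = ENNReal.ofReal (∫ t in I.carrier, C * ε⁻¹ * ‖u.toClass t‖) :=
        (ofReal_integral_eq_lintegral_ofReal (u.integrable.norm.const_mul _)
          (ae_of_all _ fun t => by positivity)).symm
    _ ≤ 1 := by
        rw [ENNReal.ofReal_le_one, integral_const_mul]
        calc C * ε⁻¹ * ∫ t in I.carrier, ‖u.toClass t‖ ≤ C * ε⁻¹ * (ε / C) :=
              mul_le_mul_of_nonneg_left hδ (by positivity)
          _ = 1 := by field_simp

theorem lintegral_bounded_lt (w : boundedMeasurable ℝ (EuclideanSpace ℝ (Fin n))) :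
    ∫⁻ t in I.carrier, ENNReal.ofReal (G (w t)) < ∞ := by
  obtain ⟨M, hM⟩ := exists_bound w
  obtain ⟨C, -, hC⟩ := G.exists_bound_of_norm_le M
  refine (lintegral_mono fun t => ENNReal.ofReal_le_ofReal (hC _ (hM t))).trans_lt ?_
  rw [lintegral_const]
  exact ENNReal.mul_lt_top ENNReal.ofReal_lt_top (measure_lt_top _ _)

/-- Bounded functions belong to `L^G`. -/
noncomputable def ofBounded : boundedMeasurable ℝ (EuclideanSpace ℝ (Fin n)) →ₗ[ℝ] OrliczSpace G I where
  toFun w := mk w (stronglyMeasurable w).aestronglyMeasurable (lintegral_bounded_lt w)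
  map_add' v w := by
    refine ext_ae ?_
    filter_upwards [coe_mk _ (lintegral_bounded_lt (G := G) (I := I) (v + w)),
      coe_add (mk _ _ (lintegral_bounded_lt v)) (mk _ _ (lintegral_bounded_lt w)),
      coe_mk _ (lintegral_bounded_lt v), coe_mk _ (lintegral_bounded_lt w)] with t h1 h2 h3 h4
    rw [h1, h2, h3, h4]
    rfl
  map_smul' c w := by
    refine ext_ae ?_
    filter_upwards [coe_mk _ (lintegral_bounded_lt (G := G) (I := I) (c • w)),
      coe_smul c (mk _ _ (lintegral_bounded_lt w)),
      coe_mk _ (lintegral_bounded_lt w)] with t h1 h2 h3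
    rw [h1, RingHom.id_apply, h2, h3]
    rfl

theorem coe_ofBounded (w : boundedMeasurable ℝ (EuclideanSpace ℝ (Fin n))) :
    (ofBounded w : OrliczSpace G I).toClass =ᵐ[I.measure] w := coe_mk _ (lintegral_bounded_lt w)

theorem tendsto_integral_norm {w : ℕ → boundedMeasurable ℝ (EuclideanSpace ℝ (Fin n))}
    (h1 : ∀ k t, ‖w k t‖ ≤ 1) (hw : ∀ᵐ t ∂I.measure, Tendsto (fun k => w k t) atTop (𝓝 0)) :
    Tendsto (fun k => ∫ t in I.carrier, ‖w k t‖) atTop (𝓝 0) := by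
  have := tendsto_integral_of_dominated_convergence (μ := I.measure) (fun _ => (1 : ℝ))
    (F := fun k t => ‖w k t‖) (f := fun _ => 0)
    (fun k => (stronglyMeasurable (w k)).norm.aestronglyMeasurable) (integrable_const _)
    (fun k => ae_of_all _ fun t => by rw [norm_norm]; exact h1 k t) ?_
  · simpa using this
  · filter_upwards [hw] with t ht
    simpa using ht.norm

/-- Bounded almost everywhere convergence implies `L¹` convergence, which on bounded subsets of
`L^∞` implies convergence in `L^G`. Hence `F` has a density. -/
theorem isBoundedlyContinuous_comp_ofBounded (F : StrongDual ℝ (OrliczSpace G I)) :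
    IsBoundedlyContinuous I.measure ((F : OrliczSpace G I →ₗ[ℝ] ℝ) ∘ₗ ofBounded) := by
  intro w h1 hw
  have hlim : Tendsto (fun k => (ofBounded (w k) : OrliczSpace G I)) atTop (𝓝 0) := by
    rw [NormedAddGroup.tendsto_nhds_zero]
    intro ε hε
    obtain ⟨δ, hδ, h⟩ := norm_le_of_integral_norm_le G I 1 (half_pos hε)
    filter_upwards [(tendsto_integral_norm h1 hw).eventually_lt_const hδ] with k hk
    refine (h _ ?_ ?_).trans_lt (half_lt_self hε)
    · filter_upwards [coe_ofBounded (G := G) (I := I) (w k)] with t ht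
      rw [ht]
      exact h1 k t
    · refine le_of_eq_of_le (integral_congr_ae ?_) hk.le
      filter_upwards [coe_ofBounded (G := G) (I := I) (w k)] with t ht
      rw [ht]
  have := (F.continuous.tendsto 0).comp hlim
  rwa [map_zero] at this

theorem cut_ofBounded {A : Set ℝ} (hA : MeasurableSet A)
    (w : boundedMeasurable ℝ (EuclideanSpace ℝ (Fin n))) :
    cut hA (ofBounded w : OrliczSpace G I) = ofBounded (restrict hA w) := by
  refine ext_ae ?_
  filter_upwards [coe_cut hA (ofBounded w : OrliczSpace G I),
    coe_ofBounded (G := G) (I := I) w, coe_ofBounded (G := G) (I := I) (restrict hA w)]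
    with t h1 h2 h3
  rw [h1, h3, coe_restrict]
  by_cases ht : t ∈ A <;> simp [ht, h2]

/-- Truncations converge. -/
theorem tendsto_ofBounded_truncate (u : OrliczSpace G I) :
    Tendsto (fun k => (ofBounded (truncate u.toClass.stronglyMeasurable k) : OrliczSpace G I))
      atTop (𝓝 u) := by
  -- The truncation error is `u` cut to its superlevel sets, and every point eventually leaves
  -- these.
  have h := tendsto_cut (measurableSet_superlevel u.toClass.stronglyMeasurable)
    (ae_of_all _ (eventually_notMem_superlevel u.toClass)) u
  have h2 := (tendsto_const_nhds (x := u)).sub h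
  rw [sub_zero] at h2
  refine h2.congr fun k => ?_
  rw [sub_eq_iff_eq_add, ← cut_compl_add_cut (measurableSet_superlevel
    u.toClass.stronglyMeasurable k) u]
  congr 1
  · refine ext_ae ?_
    filter_upwards [coe_cut (measurableSet_superlevel u.toClass.stronglyMeasurable k).compl u,
      coe_ofBounded (G := G) (I := I) (truncate u.toClass.stronglyMeasurable k)] with t h1 h2
    rw [cut_compl_add_cut, h1, h2, coe_truncate]
  · rw [cut_compl_add_cut]

theorem denseRange_ofBounded :
    DenseRange (ofBounded : boundedMeasurable ℝ (EuclideanSpace ℝ (Fin n)) → OrliczSpace G I) :=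
  fun u => mem_closure_of_tendsto (tendsto_ofBounded_truncate u)
    (Eventually.of_forall fun _ => mem_range_self _)

theorem integrable_inner (v : boundedMeasurable ℝ (EuclideanSpace ℝ (Fin n)))
    (u : OrliczSpace G I) : Integrable (fun t => inner ℝ (v t) (u.toClass t)) I.measure := by
  obtain ⟨C, hC⟩ := exists_bound v
  refine (u.integrable.norm.const_mul C).mono'
    ((stronglyMeasurable v).aestronglyMeasurable.inner u.toClass.aestronglyMeasurable)
    (ae_of_all _ fun t => ?_)
  exact (norm_inner_le_norm _ _).trans (mul_le_mul_of_nonneg_right (hC t) (norm_nonneg _))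

/-- A bounded function as a functional on `L^G`, as a linear map. -/
noncomputable def pairingₗ (v : boundedMeasurable ℝ (EuclideanSpace ℝ (Fin n))) :
    OrliczSpace G I →ₗ[ℝ] ℝ where
  toFun u := ∫ t in I.carrier, inner ℝ (v t) (u.toClass t)
  map_add' u w := by
    rw [← integral_add (integrable_inner v u) (integrable_inner v w)]
    refine integral_congr_ae ?_
    filter_upwards [coe_add u w] with t ht
    rw [ht, inner_add_right]
  map_smul' c u := by
    rw [RingHom.id_apply, smul_eq_mul, ← integral_const_mul]
    refine integral_congr_ae ?_
    filter_upwards [coe_smul c u] with t ht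
    rw [ht, inner_smul_right]

theorem norm_pairingₗ_le (v : boundedMeasurable ℝ (EuclideanSpace ℝ (Fin n)))
    (u : OrliczSpace G I) : ‖pairingₗ v u‖ ≤ ∫ t in I.carrier, ‖v t‖ * ‖u.toClass t‖ := by
  obtain ⟨C, hC⟩ := exists_bound v
  refine norm_integral_le_of_norm_le (Integrable.bdd_mul (c := C) u.integrable.norm
    (stronglyMeasurable v).norm.aestronglyMeasurable (ae_of_all _ fun t => ?_))
    (ae_of_all _ fun t => norm_inner_le_norm _ _)
  rw [norm_norm]
  exact hC t

/-- A bounded function as a functional on `L^G`. -/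
noncomputable def pairing : boundedMeasurable ℝ (EuclideanSpace ℝ (Fin n)) →ₗ[ℝ]
    StrongDual ℝ (OrliczSpace G I) where
  toFun v := LinearMap.mkContinuousOfExistsBound (pairingₗ v) (by
    obtain ⟨C, hC⟩ := exists_bound v
    obtain ⟨c, hc, h⟩ := integral_norm_le G I
    have hC0 : 0 ≤ C := (norm_nonneg _).trans (hC 0)
    refine ⟨C * c, fun u => (norm_pairingₗ_le v u).trans ?_⟩
    calc ∫ t in I.carrier, ‖v t‖ * ‖u.toClass t‖ ≤ ∫ t in I.carrier, C * ‖u.toClass t‖ := by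
          refine integral_mono_of_nonneg (ae_of_all _ fun t => by positivity)
            (u.integrable.norm.const_mul C) (ae_of_all _ fun t => ?_)
          exact mul_le_mul_of_nonneg_right (hC t) (norm_nonneg _)
      _ ≤ C * c * ‖u‖ := by
          rw [integral_const_mul, mul_assoc]
          exact mul_le_mul_of_nonneg_left (h u) hC0)
  map_add' v w := by
    refine ContinuousLinearMap.ext fun u => ?_
    change ∫ t in I.carrier, inner ℝ (v t + w t) (u.toClass t) = _
    simp_rw [inner_add_left]
    exact integral_add (integrable_inner v u) (integrable_inner w u)
  map_smul' c v := by
    refine ContinuousLinearMap.ext fun u => ?_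
    change ∫ t in I.carrier, inner ℝ (c • v t) (u.toClass t) = _
    simp_rw [real_inner_smul_left]
    exact integral_const_mul _ _

theorem pairing_apply (v : boundedMeasurable ℝ (EuclideanSpace ℝ (Fin n))) (u : OrliczSpace G I) :
    pairing v u = ∫ t in I.carrier, inner ℝ (v t) (u.toClass t) := rfl

theorem pairing_ofBounded (v w : boundedMeasurable ℝ (EuclideanSpace ℝ (Fin n))) :
    pairing v (ofBounded w : OrliczSpace G I) = ∫ t in I.carrier, inner ℝ (v t) (w t) := by
  refine integral_congr_ae ?_
  filter_upwards [coe_ofBounded (G := G) (I := I) w] with t ht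
  rw [ht]

theorem pairing_restrict {A : Set ℝ} (hA : MeasurableSet A)
    (v : boundedMeasurable ℝ (EuclideanSpace ℝ (Fin n))) :
    (pairing (restrict hA v) : StrongDual ℝ (OrliczSpace G I)) = (pairing v).comp (cut hA) := by
  refine ContinuousLinearMap.ext fun u => ?_
  refine integral_congr_ae ?_
  filter_upwards [coe_cut hA u] with t ht
  rw [coe_restrict, inner_indicator_left_eq]
  exact congrArg (inner ℝ (v t)) ht.symm

theorem norm_pairing_restrict_le {A : Set ℝ} (hA : MeasurableSet A)
    (v : boundedMeasurable ℝ (EuclideanSpace ℝ (Fin n))) :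
    ‖(pairing (restrict hA v) : StrongDual ℝ (OrliczSpace G I))‖ ≤
      ‖(pairing v : StrongDual ℝ (OrliczSpace G I))‖ := by
  rw [pairing_restrict]
  exact (ContinuousLinearMap.opNorm_comp_le _ _).trans
    (mul_le_of_le_one_right (norm_nonneg _) (norm_cut_le_one hA))

/-- This provides `Φ` with a density. By equi-integrability of the unit ball of `L^G`, weights
tending to `0` in `L¹` and bounded by `1` give functionals tending to `0` in the dual norm. -/
theorem isBoundedlyContinuous_comp_pairing (Φ : StrongDual ℝ (StrongDual ℝ (OrliczSpace G I))) :
    IsBoundedlyContinuous I.measure ((Φ : StrongDual ℝ (OrliczSpace G I) →ₗ[ℝ] ℝ) ∘ₗ pairing) := by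
  intro w h1 hw
  have hlim : Tendsto (fun k => (pairing (w k) : StrongDual ℝ (OrliczSpace G I))) atTop (𝓝 0) := by
    rw [NormedAddGroup.tendsto_nhds_zero]
    intro ε hε
    obtain ⟨R, hR0, hR⟩ := integral_mul_norm_le G I (half_pos hε)
    have hlim := (tendsto_integral_norm h1 hw).const_mul R
    rw [mul_zero] at hlim
    filter_upwards [hlim.eventually_lt_const (half_pos hε)] with k hk
    have hnn : 0 ≤ R * ∫ t in I.carrier, ‖w k t‖ :=
      mul_nonneg hR0 (integral_nonneg fun t => norm_nonneg _)
    refine (ContinuousLinearMap.opNorm_le_bound _ (by positivity) fun u =>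
      (norm_pairingₗ_le (w k) u).trans (hR (fun t => ‖w k t‖)
        (stronglyMeasurable (w k)).norm.aestronglyMeasurable (fun t => norm_nonneg _)
        (fun t => h1 k t) u)).trans_lt ?_
    linarith
  have := (Φ.continuous.tendsto 0).comp hlim
  rwa [map_zero] at this

/-- Functionals given by bounded functions are dense in the dual of `L^G`. -/
theorem denseRange_pairing :
    DenseRange (pairing : boundedMeasurable ℝ (EuclideanSpace ℝ (Fin n)) →
      StrongDual ℝ (OrliczSpace G I)) := by
  intro F
  obtain ⟨g, hgm, -, hg⟩ := (isBoundedlyContinuous_comp_ofBounded F).exists_density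
  have hgs : StronglyMeasurable g := hgm.stronglyMeasurable
  rw [Metric.mem_closure_range_iff]
  intro ε hε
  obtain ⟨k, hk⟩ := exists_norm_comp_cut_le F (measurableSet_superlevel hgs)
    (superlevel_antitone g) (ae_of_all _ (eventually_notMem_superlevel g)) (half_pos hε)
  refine ⟨truncate hgs k, ?_⟩
  -- On bounded functions `F` is integration against `g`, so subtracting the truncated density
  -- leaves `F` on the set where `‖g‖ > k`. Density extends this to `L^G`, and absolute continuity
  -- of the dual norm makes the remainder small.
  have e : F - pairing (truncate hgs k) = F.comp (cut (measurableSet_superlevel hgs k)) := by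
    rw [sub_eq_iff_eq_add']
    refine ContinuousLinearMap.ext fun u => ?_
    refine denseRange_ofBounded.induction_on u (isClosed_eq F.continuous
      (ContinuousLinearMap.continuous _)) fun w => ?_
    rw [_root_.add_apply, pairing_ofBounded, ContinuousLinearMap.comp_apply]
    have h1 := cut_compl_add_cut (measurableSet_superlevel hgs k) (ofBounded w : OrliczSpace G I)
    have h2 := hg (restrict (measurableSet_superlevel hgs k).compl w)
    rw [LinearMap.comp_apply, ← cut_ofBounded] at h2
    simp_rw [coe_restrict, ← inner_indicator_left_eq] at h2
    conv_lhs => rw [← h1]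
    rw [map_add]
    exact congrArg (· + _) h2
  rw [dist_eq_norm, e]
  exact hk.trans_lt (half_lt_self hε)

/-- `L^G` is reflexive. -/
theorem isReflexiveSpace : IsReflexiveSpace (OrliczSpace G I) := by
  rw [isReflexiveSpace_iff]
  intro Φ
  obtain ⟨g, hgm, -, hg⟩ := (isBoundedlyContinuous_comp_pairing Φ).exists_density
  have hgs : StronglyMeasurable g := hgm.stronglyMeasurable
  have hΦ : ∀ v, Φ (pairing v) = ∫ t in I.carrier, inner ℝ (g t) (v t) := hg
  -- The norm is tested on the dense functionals `pairing v`. Moving the cutoff from `g` to `v`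
  -- turns the value into `Φ` at a restricted pairing, and restriction does not increase the dual
  -- norm.
  have hnorm : ∀ k, ‖(ofBounded (truncate hgs k) : OrliczSpace G I)‖ ≤ ‖Φ‖ := by
    intro k
    refine NormedSpace.norm_le_dual_bound ℝ _ (norm_nonneg Φ) fun F => ?_
    refine denseRange_pairing.induction_on F (isClosed_le (by fun_prop) (by fun_prop)) fun v => ?_
    have e : pairing v (ofBounded (truncate hgs k) : OrliczSpace G I) =
        Φ (pairing (restrict (measurableSet_superlevel hgs k).compl v)) := by
      rw [hΦ, pairing_ofBounded]
      refine integral_congr_ae (ae_of_all _ fun t => ?_)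
      simp only [coe_restrict, coe_truncate]
      rw [← inner_indicator_left_eq, real_inner_comm]
    rw [e]
    exact (Φ.le_opNorm _).trans
      (mul_le_mul_of_nonneg_left (norm_pairing_restrict_le _ v) (norm_nonneg _))
  have hα : 0 < ‖Φ‖ + 1 := by positivity
  -- Fatou's lemma along the truncations; `‖Φ‖ + 1` lies strictly above all their norms, so each
  -- modular is at most `1`.
  have hfin : ∫⁻ t in I.carrier, ENNReal.ofReal (G ((‖Φ‖ + 1)⁻¹ • g t)) < ∞ := by
    refine lt_of_le_of_lt ?_ ENNReal.one_lt_top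
    calc ∫⁻ t in I.carrier, ENNReal.ofReal (G ((‖Φ‖ + 1)⁻¹ • g t))
        = ∫⁻ t in I.carrier, liminf (fun k =>
            ENNReal.ofReal (G ((‖Φ‖ + 1)⁻¹ • truncate hgs k t))) atTop := by
          refine lintegral_congr fun t => (Tendsto.liminf_eq ?_).symm
          refine tendsto_const_nhds.congr' ?_
          filter_upwards [eventually_notMem_superlevel g t] with k hk
          rw [coe_truncate, indicator_of_mem (mem_compl hk)]
      _ ≤ liminf (fun k => ∫⁻ t in I.carrier,
            ENNReal.ofReal (G ((‖Φ‖ + 1)⁻¹ • truncate hgs k t))) atTop :=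
          lintegral_liminf_le' fun k =>
            aemeasurable_apply_smul (stronglyMeasurable _).aestronglyMeasurable _
      _ ≤ 1 := by
          refine liminf_le_of_frequently_le' (Frequently.of_forall fun k => ?_)
          have h := modular_le_one_of_norm_lt ((hnorm k).trans_lt (lt_add_one ‖Φ‖))
          rw [modular_smul_eq] at h
          refine le_of_eq_of_le (lintegral_congr_ae ?_) h
          filter_upwards [coe_ofBounded (G := G) (I := I) (truncate hgs k)] with t ht
          rw [ht]
  have hm : AEStronglyMeasurable (fun t => (‖Φ‖ + 1)⁻¹ • g t) I.measure :=
    (hgs.fun_const_smul _).aestronglyMeasurable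
  have hae : ∀ᵐ t ∂I.measure, ((‖Φ‖ + 1) • mk _ hm hfin : OrliczSpace G I).toClass t = g t := by
    filter_upwards [coe_smul (‖Φ‖ + 1) (mk _ hm hfin : OrliczSpace G I), coe_mk hm hfin]
      with t h1 h2
    rw [h1, h2, smul_inv_smul₀ hα.ne']
  -- The finite modular is known for `g / (‖Φ‖ + 1)`; scaling back inside the vector space recovers
  -- `g`.
  refine ⟨(‖Φ‖ + 1) • mk _ hm hfin, fun F => ?_⟩
  refine denseRange_pairing.induction_on F (isClosed_eq (by fun_prop) (by fun_prop)) fun v => ?_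
  rw [hΦ, pairing_apply]
  refine integral_congr_ae ?_
  filter_upwards [hae] with t ht
  rw [ht, real_inner_comm]

end OrliczSpace

/-! ### Separability of `L^G` and closedness of the weak derivative -/

namespace OrliczSpace

open boundedMeasurable

variable {n : ℕ} {G : GFunction n} {I : FiniteInterval}

theorem dist_toL1 (u v : OrliczSpace G I) :
    dist (u.integrable.toL1 u.toClass) (v.integrable.toL1 v.toClass) =
      ∫ t in I.carrier, ‖(u - v).toClass t‖ := by
  rw [dist_eq_norm, ← Integrable.toL1_sub, L1.norm_eq_integral_norm]
  refine integral_congr_ae ?_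
  filter_upwards [(u.integrable.sub v.integrable).coeFn_toL1, coe_sub u v] with t h1 h2
  rw [h1, h2, Pi.sub_apply]

/-- Bounded sets of `L^∞` are separable in `L^G`. -/
theorem isSeparable_setOf_norm_le (k : ℕ) :
    TopologicalSpace.IsSeparable
      {u : OrliczSpace G I | ∀ᵐ t ∂I.measure, ‖u.toClass t‖ ≤ k} := by
  let S : Set (OrliczSpace G I) := {u | ∀ᵐ t ∂I.measure, ‖u.toClass t‖ ≤ k}
  let f : S → (ℝ →₁[I.measure] EuclideanSpace ℝ (Fin n)) :=
    fun u => u.1.integrable.toL1 u.1.toClass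
  obtain ⟨c, hc, h⟩ := integral_norm_le G I
  -- On `S` the uniformities of `L^G` and `L¹` coincide, so `S` inherits second countability from
  -- `L¹`.
  have hf : IsUniformInducing f := by
    rw [Metric.isUniformInducing_iff]
    refine ⟨(LipschitzWith.of_dist_le_mul (K := ⟨c, hc⟩) fun u v => ?_).uniformContinuous,
      fun ε hε => ?_⟩
    · refine (dist_toL1 u.1 v.1).trans_le ((h _).trans_eq ?_)
      rw [Subtype.dist_eq, dist_eq_norm]
      rfl
    · obtain ⟨δ, hδ, hB⟩ := norm_le_of_integral_norm_le G I (k + k) (half_pos hε)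
      refine ⟨δ, hδ, fun {u v} huv => ?_⟩
      rw [Subtype.dist_eq, dist_eq_norm]
      refine (hB _ ?_ ((dist_toL1 u.1 v.1).symm.trans_le huv.le)).trans_lt (half_lt_self hε)
      filter_upwards [coe_sub u.1 v.1, u.2, v.2] with t h1 h2 h3
      rw [h1]
      exact (norm_sub_le _ _).trans (add_le_add h2 h3)
  have : Fact ((1 : ℝ≥0∞) ≠ ∞) := ⟨ENNReal.one_ne_top⟩
  have : SecondCountableTopology S := hf.isInducing.secondCountableTopology
  exact TopologicalSpace.IsSeparable.of_subtype S

/-- `L^G` is separable. -/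
instance separableSpace : TopologicalSpace.SeparableSpace (OrliczSpace G I) := by
  rw [← TopologicalSpace.isSeparable_univ_iff]
  refine (TopologicalSpace.IsSeparable.iUnion fun k : ℕ =>
    isSeparable_setOf_norm_le (G := G) (I := I) k).closure.mono fun u _ => ?_
  refine mem_closure_of_tendsto (tendsto_ofBounded_truncate u) (Eventually.of_forall fun k => ?_)
  refine mem_iUnion.2 ⟨k, ?_⟩
  filter_upwards [coe_ofBounded (G := G) (I := I) (truncate u.toClass.stronglyMeasurable k)]
    with t ht
  rw [ht, coe_truncate]
  by_cases hx : t ∈ (superlevel u.toClass k)ᶜ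
  · rw [indicator_of_mem hx]
    exact not_lt.1 hx
  · rw [indicator_of_notMem hx, norm_zero]
    exact Nat.cast_nonneg k

theorem continuous_integral_smul {φ : ℝ → ℝ} (hφ : Continuous φ) (hc : HasCompactSupport φ) :
    Continuous fun u : OrliczSpace G I => ∫ t in I.carrier, φ t • u.toClass t := by
  obtain ⟨C, hC⟩ := hc.exists_bound_of_continuous hφ
  obtain ⟨c, -, h⟩ := integral_norm_le G I
  have hC0 : 0 ≤ C := (norm_nonneg _).trans (hC 0)
  let L : OrliczSpace G I →ₗ[ℝ] EuclideanSpace ℝ (Fin n) :=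
    { toFun := fun u => ∫ t in I.carrier, φ t • u.toClass t
      map_add' := integral_smul_add hφ hc
      map_smul' := integral_smul_smul φ }
  refine AddMonoidHomClass.continuous_of_bound L (C * c) fun u => ?_
  refine (norm_integral_le_of_norm_le (u.integrable.norm.const_mul C)
    (ae_of_all _ fun t => ?_)).trans ?_
  · rw [norm_smul]
    exact mul_le_mul_of_nonneg_right (hC t) (norm_nonneg _)
  · rw [integral_const_mul, mul_assoc]
    exact mul_le_mul_of_nonneg_left (h u) hC0

/-- The graph of the weak derivative is closed. -/
theorem isClosed_setOf_hasDeriv :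
    IsClosed {p : OrliczSpace G I × OrliczSpace G I | p.1.HasDeriv p.2} := by
  -- Local integrability is automatic in `L^G`, so only the test-function identities remain, and
  -- both sides of each are continuous.
  have e : {p : OrliczSpace G I × OrliczSpace G I | p.1.HasDeriv p.2} =
      ⋂ φ : ℝ → ℝ, ⋂ _ : ContDiff ℝ (⊤ : ℕ∞) φ, ⋂ _ : HasCompactSupport φ,
        ⋂ _ : tsupport φ ⊆ interior I.carrier,
        {p | ∫ t in I.carrier, deriv φ t • p.1.toClass t =
          - ∫ t in I.carrier, φ t • p.2.toClass t} := by
    ext p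
    simp only [mem_iInter, mem_ofPred_eq]
    exact ⟨fun h => h.2.2, fun h => ⟨locallyIntegrableOn _, locallyIntegrableOn _, h⟩⟩
  rw [e]
  refine isClosed_iInter fun φ => isClosed_iInter fun h1 => isClosed_iInter fun h2 =>
    isClosed_iInter fun _ => isClosed_eq ?_ ?_
  · exact (continuous_integral_smul (h1.continuous_deriv (by simp)) h2.deriv).comp continuous_fst
  · exact ((continuous_integral_smul h1.continuous h2).comp continuous_snd).neg

end OrliczSpace

/-! ### Transfer to `W¹L^G` through the graph embedding -/

namespace OrliczSobolevSpace

variable {n : ℕ} {G : GFunction n} {I : FiniteInterval}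

/-- The embedding `u ↦ (u, u̇)` into `L^G × L^G`. -/
noncomputable def toProd : OrliczSobolevSpace G I →L[ℝ] OrliczSpace G I × OrliczSpace G I :=
  (toOrlicz.prod weakDeriv).mkContinuous 1 fun u => by
    rw [one_mul]
    exact max_le (le_add_of_nonneg_right (norm_nonneg _)) (le_add_of_nonneg_left (norm_nonneg _))

/-- The product carries the maximum norm, and a sum of two terms is at most twice their maximum. -/
theorem antilipschitz_toProd :
    AntilipschitzWith 2 (toProd : OrliczSobolevSpace G I → OrliczSpace G I × OrliczSpace G I) := by
  refine AddMonoidHomClass.antilipschitz_of_bound toProd fun u => ?_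
  have h1 : ‖u.toOrlicz‖ ≤ ‖toProd u‖ := le_max_left _ _
  have h2 : ‖weakDeriv u‖ ≤ ‖toProd u‖ := le_max_right _ _
  rw [norm_def]
  push_cast
  linarith

/-- By uniqueness of weak derivatives the range is the whole graph of the weak derivative, which is
closed. -/
theorem isClosed_range_toProd :
    IsClosed (range (toProd : OrliczSobolevSpace G I → OrliczSpace G I × OrliczSpace G I)) := by
  convert OrliczSpace.isClosed_setOf_hasDeriv (G := G) (I := I) using 1
  ext ⟨u, v⟩
  refine ⟨?_, fun h => ?_⟩
  · rintro ⟨w, hw⟩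
    rw [← hw]
    exact w.hasDeriv_weakDeriv
  · let w : OrliczSobolevSpace G I := ⟨u, v, h⟩
    exact ⟨w, Prod.ext rfl (w.hasDeriv_weakDeriv.unique h)⟩

theorem isReflexiveSpace : IsReflexiveSpace (OrliczSobolevSpace G I) :=
  (OrliczSpace.isReflexiveSpace.prod OrliczSpace.isReflexiveSpace).of_antilipschitz toProd
    antilipschitz_toProd isClosed_range_toProd

theorem separableSpace : TopologicalSpace.SeparableSpace (OrliczSobolevSpace G I) := by
  have : SecondCountableTopology (OrliczSpace G I) := UniformSpace.secondCountable_of_separable _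
  have : SecondCountableTopology (OrliczSobolevSpace G I) :=
    (antilipschitz_toProd.isUniformInducing
      toProd.uniformContinuous).isInducing.secondCountableTopology
  infer_instance

end OrliczSobolevSpace

theorem mainTheorem11 {n : ℕ} (G : GFunction n) (I : FiniteInterval) :
    CompleteSpace (OrliczSobolevSpace G I) ∧
      TopologicalSpace.SeparableSpace (OrliczSobolevSpace G I) ∧
      IsReflexiveSpace (OrliczSobolevSpace G I) :=
  ⟨OrliczSobolevSpace.isReflexiveSpace.completeSpace, OrliczSobolevSpace.separableSpace,
    OrliczSobolevSpace.isReflexiveSpace⟩
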